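/- Let $K\subset\mathbb{R}^3$ be a knot, i.e. the image of a $C^2$ embedding (injective immersion) of the circle, given by a $1$-periodic parametrization $s\mapsto K(s)$, and let $\Delta$ be the diagonal of $K\times K$. Let $dx,dy$ denote arc-length elements and let $d_K(x,y)$ be the length of the shorter arc of $K$ between $x$ and $y$. The Möbius energy of $K$ is $$E_\circ^{(2)}(K)=-4+\iint_{K\times K}\left(\frac1{|x-y|^2}-\frac1{d_K(x,y)^2}\right)dx\,dy .$$ For $x=K(s)\neq y=K(t)$ let $\Sigma\subset\mathbb{R}^3\cup\{\infty\}$ be a $2$-sphere (round sphere or plane) tangent to $K$ at both $x$ and $y$, and let $p$ be a stereographic projection of $\Sigma$ to $\mathbb{C}\cup\{\infty\}$ from a point of $\Sigma\cap\mathbb{R}^3$ other than $x$ and $y$. Put $\tilde x=p(x)$, $\tilde y=p(y)$, $\widetilde{dx}=dp_x(K'(s))\,ds$, $\widetilde{dy}=dp_y(K'(t))\,dt$. The infinitesimal cross ratio $\Omega_K(x,y)$ is the leading term of the cross ratio $$(\tilde x+\widetilde{dx},\tilde y;\tilde x,\tilde y+\widetilde{dy})=\frac{(\tilde x+\widetilde{dx})-\tilde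 x}{(\tilde x+\widetilde{dx})-(\tilde y+\widetilde{dy})}:\frac{\tilde y-\tilde x}{\tilde y-(\tilde y+\widetilde{dy})}\sim\frac{\widetilde{dx}\,\widetilde{dy}}{(\tilde x-\tilde y)^2},$$ written $\Omega_K=\omega(s,t)\,ds\,dt$ with $\omega(s,t)\in\mathbb{C}$, where the orientation of $\Sigma$ is chosen so that $\operatorname{Im}\omega\ge 0$. Then $\Omega_K(x,y)$ exists and is independent of the choice of $\Sigma$ and $p$ for all $(x,y)\in K\times K\setminus\Delta$; the integrands of $E_\circ^{(2)}(K)$ and of $\iint_{K\times K\setminus\Delta}(|\Omega_K|-\operatorname{Re}\Omega_K)$ are absolutely integrable; and $$E_\circ^{(2)}(K)=\iint_{K\times K\setminus\Delta}\bigl(|\Omega_K|-\operatorname{Re}\Omega_K\bigr),$$ where $|\Omega_K|=|\omega|\,ds\,dt$ and $\operatorname{Re}\Omega_K=(\operatorname{Re}\omega)\,ds\,dt$. -/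

import Mathlib

open scoped Topology

noncomputable section

/-- Euclidean three-space. -/
abbrev E3 : Type := EuclideanSpace ℝ (Fin 3)

/-- A knot: a `C²` embedding of the circle `ℝ/ℤ` in `ℝ³`, written as a `1`-periodic immersion of
the line which is injective on a period. -/
structure Knot where
  toFun : ℝ → E3
  contDiff : ContDiff ℝ 2 toFun
  periodic : Function.Periodic toFun 1
  immersion : ∀ s, deriv toFun s ≠ 0
  injOn : Set.InjOn toFun (Set.Ico 0 1)

namespace Knot

variable (K : Knot)

/-- The velocity vector at the parameter `s`. -/
def velocity (s : ℝ) : E3 := deriv K.toFun s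

/-- The (signed) length of the arc from the parameter `a` to the parameter `b`. -/
def arcLength (a b : ℝ) : ℝ := ∫ u in a..b, ‖K.velocity u‖

/-- The total length of the knot. -/
def length : ℝ := K.arcLength 0 1

/-- The length of the shorter of the two arcs of the knot between the points with parameters
`s, t ∈ [0, 1)`. -/
def arcDist (s t : ℝ) : ℝ := min |K.arcLength s t| (K.length - |K.arcLength s t|)

/-- The square `[0, 1)²`, in bijection with `K × K`. -/
def square : Set (ℝ × ℝ) := Set.Ico 0 1 ×ˢ Set.Ico 0 1

/-- The square without its diagonal, in bijection with `K × K` without its diagonal. -/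
def offDiagSquare : Set (ℝ × ℝ) := {p ∈ square | p.1 ≠ p.2}

/-- The coefficient with respect to `ds dt` of `(1 / |x - y|² - 1 / d_K(x, y)²) dx dy`, where
`x = K(s)`, `y = K(t)` and `dx`, `dy` are the arc-length elements. -/
def energyIntegrand (p : ℝ × ℝ) : ℝ :=
  (1 / ‖K.toFun p.1 - K.toFun p.2‖ ^ 2 - 1 / K.arcDist p.1 p.2 ^ 2) *
    (‖K.velocity p.1‖ * ‖K.velocity p.2‖)

/-- The Möbius energy `-4 + ∬_{K × K} (1 / |x - y|² - 1 / d_K(x, y)²) dx dy`. -/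
def energy : ℝ := -4 + ∫ p in square, K.energyIntegrand p

end Knot

/-- A `2`-sphere in `ℝ³ ∪ {∞}`, with the equation `a |v|² + 2 ⟨b, v⟩ + c = 0`, where
`|b|² - a c > 0`. If `a ≠ 0` it is the round sphere with centre `-b / a` and radius
`√(|b|² - a c) / |a|`; if `a = 0` it is the plane `2 ⟨b, v⟩ + c = 0` (with the point at infinity)
and `b ≠ 0`. -/
structure TwoSphere where
  a : ℝ
  b : E3
  c : ℝ
  nondegenerate : 0 < ‖b‖ ^ 2 - a * c

namespace TwoSphere

/-- The finite points of the sphere. -/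
def carrier (S : TwoSphere) : Set E3 :=
  {v | S.a * ‖v‖ ^ 2 + 2 * inner ℝ S.b v + S.c = 0}

/-- The tangent plane, as a linear subspace, at a finite point `v` of the sphere: the vectors
orthogonal to the (nonzero) half gradient `a v + b` of the equation. -/
def tangentSpace (S : TwoSphere) (v : E3) : Submodule ℝ E3 := (ℝ ∙ (S.a • v + S.b))ᗮ

/-- The sphere is tangent to the knot at the point with parameter `s`. -/
def IsTangentAt (S : TwoSphere) (K : Knot) (s : ℝ) : Prop :=
  K.toFun s ∈ S.carrier ∧ K.velocity s ∈ S.tangentSpace (K.toFun s)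

end TwoSphere

/-- A stereographic projection of the sphere `S` from a point `N` of `S` to `ℂ`. The inversion with
centre `N` takes `S ∖ {N}` to a plane parallel to the tangent plane of `S` at `N`, and
`e₁, e₂` are orthonormal coordinate vectors of that plane. Both orientations are allowed. -/
structure StereographicProjection (S : TwoSphere) where
  pole : E3
  pole_mem : pole ∈ S.carrier
  radius : ℝ
  radius_pos : 0 < radius
  e₁ : E3
  e₂ : E3
  e₁_mem : e₁ ∈ S.tangentSpace pole
  e₂_mem : e₂ ∈ S.tangentSpace pole
  norm_e₁ : ‖e₁‖ = 1
  norm_e₂ : ‖e₂‖ = 1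
  orthogonal : inner ℝ e₁ e₂ = 0

namespace StereographicProjection

variable {S : TwoSphere} (p : StereographicProjection S)

/-- The value of the projection; the same formula is used at all points of `ℝ³ ∖ {N}`. -/
def proj (v : E3) : ℂ :=
  ⟨inner ℝ p.e₁ (EuclideanGeometry.inversion p.pole p.radius v),
    inner ℝ p.e₂ (EuclideanGeometry.inversion p.pole p.radius v)⟩

/-- The differential of the projection at `v`. -/
def dproj (v : E3) : E3 →L[ℝ] ℂ := fderiv ℝ p.proj v

end StereographicProjection

/-- The cross ratio `(z₁, z₂; z₃, z₄)`. -/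
def crossRatio (z₁ z₂ z₃ z₄ : ℂ) : ℂ :=
  ((z₁ - z₃) / (z₁ - z₄)) / ((z₂ - z₃) / (z₂ - z₄))

/-- `ω` is the coefficient with respect to `ds dt`, at the parameters `(s, t)`, of the
infinitesimal cross ratio: `S` is a sphere tangent to the knot at `x = K(s)` and `y = K(t)`, it is
projected stereographically to `ℂ` from a point other than `x` and `y`, and `ω` is the
leading coefficient of the cross ratio `(x̃ + dx̃, ỹ; x̃, ỹ + dỹ)` for `x̃`, `ỹ` the
projections of `x`, `y` and `dx̃ = dp_x(K'(s)) ds`, `dỹ = dp_y(K'(t)) dt`. The orientation of the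
sphere is the one that makes the imaginary part non-negative. -/
def IsInfinitesimalCrossRatio (K : Knot) (s t : ℝ) (ω : ℂ) : Prop :=
  0 ≤ ω.im ∧
  ∃ (S : TwoSphere) (p : StereographicProjection S),
    S.IsTangentAt K s ∧ S.IsTangentAt K t ∧
    p.pole ≠ K.toFun s ∧ p.pole ≠ K.toFun t ∧
    Filter.Tendsto
      (fun d : ℝ × ℝ =>
        crossRatio
            (p.proj (K.toFun s) + d.1 • p.dproj (K.toFun s) (K.velocity s))
            (p.proj (K.toFun t))
            (p.proj (K.toFun s))
            (p.proj (K.toFun t) + d.2 • p.dproj (K.toFun t) (K.velocity t)) /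
          ((d.1 * d.2 : ℝ) : ℂ))
      (𝓝[≠] (0 : ℝ) ×ˢ 𝓝[≠] (0 : ℝ)) (𝓝 ω)

open Classical in
/-- The infinitesimal cross ratio `Ω_K` of the knot, as the coefficient with respect to `ds dt`. -/
def infinitesimalCrossRatio (K : Knot) (s t : ℝ) : ℂ :=
  if h : ∃ ω, IsInfinitesimalCrossRatio K s t ω then h.choose else 0

/-- The coefficient with respect to `ds dt` of `|Ω_K| - Re Ω_K`. -/
def crossRatioIntegrand (K : Knot) (p : ℝ × ℝ) : ℝ :=
  ‖infinitesimalCrossRatio K p.1 p.2‖ - (infinitesimalCrossRatio K p.1 p.2).re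

end

/-!
`|Ω_K| - Re Ω_K` is a conformal-angle defect. In a stereographic picture `Re ω` is the mixed second
derivative of `log |x̃ - ỹ|`, and this does not depend on the picture, because an inversion `ι`
changes `log ‖ι x - ι y‖ - log ‖x - y‖` only by a function of `x` plus a function of `y`. So `Re ω`
is the mixed second derivative of `log ‖x - y‖` along the knot, while `|ω|` is
`‖K' s‖ ‖K' t‖ / ‖x - y‖ ^ 2`, and the sign of `Im ω` determines `ω`.

The term `|ω|` cancels against the first term of the energy, and `‖K' s‖ ‖K' t‖ / d_K(x, y) ^ 2` is
the mixed second derivative of `log d_K`. The two integrands therefore differ by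
`∂ₛ ∂ₜ log (‖x - y‖ / d_K(x, y))`. Its `t`-primitive vanishes at `t = s` and jumps, where `d_K` has
a corner at the antipode of `s`, by `4 ‖K' s‖ / L`, with `L` the length of the knot. Integration
over `s` gives the constant `4` in the energy.
-/

noncomputable section

open MeasureTheory Set Filter
open scoped RealInnerProductSpace

section MixedLogDeriv

variable {E : Type*} [NormedAddCommGroup E] [InnerProductSpace ℝ E]

/-- The mixed second derivative of `log ‖x - y‖`, in the direction `u` of `x` and the direction
`v` of `y`, as a function of `w = x - y`. -/
def mixedLogDeriv (w u v : E) : ℝ :=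
  2 * ⟪u, w⟫ * ⟪v, w⟫ / ‖w‖ ^ 4 - ⟪u, v⟫ / ‖w‖ ^ 2

lemma hasDerivAt_inner_div_norm_sq {γ : ℝ → E} {γ' : E} {t : ℝ} (x u : E)
    (hγ : HasDerivAt γ γ' t) (hx : x ≠ γ t) :
    HasDerivAt (fun t => ⟪u, x - γ t⟫ / ‖x - γ t‖ ^ 2) (mixedLogDeriv (x - γ t) u γ') t := by
  have hw : ‖x - γ t‖ ≠ 0 := norm_ne_zero_iff.2 (sub_ne_zero.2 hx)
  have hsub := hγ.const_sub x
  refine (((hasDerivAt_const t u).inner ℝ hsub).div hsub.norm_sq (pow_ne_zero 2 hw)).congr_deriv ?_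
  rw [mixedLogDeriv, inner_zero_left, add_zero, inner_neg_right, inner_neg_right,
    real_inner_comm (x - γ t) γ']
  field_simp
  ring

lemma mixedLogDeriv_eq_inner_reflection (w u v : E) :
    mixedLogDeriv w u v = ⟪u, (ℝ ∙ w).reflection v⟫ / ‖w‖ ^ 2 := by
  rw [mixedLogDeriv, Submodule.reflection_singleton_apply, inner_sub_right, two_smul,
    inner_add_right, inner_smul_right, real_inner_comm v w, RCLike.ofReal_real_eq_id, id_eq]
  ring

lemma mixedLogDeriv_neg (w u v : E) : mixedLogDeriv (-w) u v = mixedLogDeriv w u v := by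
  simp [mixedLogDeriv]

lemma mixedLogDeriv_comm (w u v : E) : mixedLogDeriv w v u = mixedLogDeriv w u v := by
  rw [mixedLogDeriv, mixedLogDeriv, real_inner_comm u v, mul_right_comm]

lemma mixedLogDeriv_smul_smul (w u v : E) (a b : ℝ) :
    mixedLogDeriv w (a • u) (b • v) = a * b * mixedLogDeriv w u v := by
  simp only [mixedLogDeriv, real_inner_smul_left, real_inner_smul_right]
  ring

lemma fderiv_inversion_apply {c x : E} (R : ℝ) (hx : x ≠ c) (u : E) :
    fderiv ℝ (EuclideanGeometry.inversion c R) x u =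
      (R / ‖x - c‖) ^ 2 • (u - (2 * ⟪u, x - c⟫ / ‖x - c‖ ^ 2) • (x - c)) := by
  rw [(EuclideanGeometry.hasFDerivAt_inversion hx).fderiv, dist_eq_norm]
  change (R / ‖x - c‖) ^ 2 • (ℝ ∙ (x - c))ᗮ.reflection u = _
  rw [Submodule.reflection_orthogonal_apply, Submodule.reflection_singleton_apply, neg_sub,
    real_inner_comm u, RCLike.ofReal_real_eq_id, id_eq, two_smul, ← add_smul, ← two_mul,
    mul_div_assoc]

lemma norm_fderiv_inversion_apply {c x : E} (R : ℝ) (hx : x ≠ c) (u : E) :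
    ‖fderiv ℝ (EuclideanGeometry.inversion c R) x u‖ = (R / ‖x - c‖) ^ 2 * ‖u‖ := by
  rw [(EuclideanGeometry.hasFDerivAt_inversion hx).fderiv, dist_eq_norm]
  change ‖(R / ‖x - c‖) ^ 2 • (ℝ ∙ (x - c))ᗮ.reflection u‖ = _
  rw [norm_smul, LinearIsometryEquiv.norm_map, norm_pow, Real.norm_eq_abs, sq_abs]

lemma inversion_sub_inversion (c x y : E) (R : ℝ) :
    EuclideanGeometry.inversion c R x - EuclideanGeometry.inversion c R y =
      (R / ‖x - c‖) ^ 2 • (x - c) - (R / ‖y - c‖) ^ 2 • (y - c) := by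
  simp [EuclideanGeometry.inversion, dist_eq_norm]

/-- Up to terms in `x` alone and in `y` alone, `log ‖x - y‖` does not change when `x` and `y` are
inverted, so its mixed second derivative is invariant. -/
lemma mixedLogDeriv_inversion {c x y : E} {R : ℝ} (hR : R ≠ 0) (hx : x ≠ c) (hy : y ≠ c)
    (hxy : x ≠ y) (u v : E) :
    mixedLogDeriv (EuclideanGeometry.inversion c R x - EuclideanGeometry.inversion c R y)
        (fderiv ℝ (EuclideanGeometry.inversion c R) x u)
        (fderiv ℝ (EuclideanGeometry.inversion c R) y v) =
      mixedLogDeriv (x - y) u v := by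
  have hnorm := EuclideanGeometry.dist_inversion_inversion hx hy R
  rw [dist_eq_norm, dist_eq_norm, dist_eq_norm, dist_eq_norm] at hnorm
  rw [mixedLogDeriv, hnorm, fderiv_inversion_apply R hx, fderiv_inversion_apply R hy,
    inversion_sub_inversion, ← sub_sub_sub_cancel_right x y c, mixedLogDeriv]
  have hX : ‖x - c‖ ≠ 0 := norm_ne_zero_iff.2 (sub_ne_zero.2 hx)
  have hY : ‖y - c‖ ≠ 0 := norm_ne_zero_iff.2 (sub_ne_zero.2 hy)
  have hXY : ‖x - c - (y - c)‖ ≠ 0 := by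
    rwa [sub_sub_sub_cancel_right, norm_ne_zero_iff, sub_ne_zero]
  generalize x - c = X at *
  generalize y - c = Y at *
  have hsq : ‖X - Y‖ ^ 2 = ‖X‖ ^ 2 - 2 * ⟪X, Y⟫ + ‖Y‖ ^ 2 := norm_sub_sq_real X Y
  simp only [inner_sub_left, inner_sub_right, real_inner_smul_left, real_inner_smul_right,
    real_inner_self_eq_norm_sq, real_inner_comm v X, real_inner_comm X Y]
  generalize ‖X - Y‖ = δ at *
  rw [show ⟪X, Y⟫ = (‖X‖ ^ 2 + ‖Y‖ ^ 2 - δ ^ 2) / 2 by linarith]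
  field_simp
  ring

end MixedLogDeriv

section ConformalDefect

variable {E : Type*} [NormedAddCommGroup E] [InnerProductSpace ℝ E]

/-- The conformal-angle defect `‖u‖ ‖v‖ (1 - cos θ) / ‖w‖ ^ 2`, where `θ` is the angle between `u`
and the mirror image of `v` in the line of `w`. For `w = x - y` this is the angle at which the
circle tangent to `u` at `x` that passes through `y` meets the one tangent to `v` at `y` that
passes through `x`. It is written with `cos θ` expressed by the mixed logarithmic derivative. -/
def conformalDefect (w u v : E) : ℝ := ‖u‖ * ‖v‖ / ‖w‖ ^ 2 - mixedLogDeriv w u v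

lemma conformalDefect_zero (u v : E) : conformalDefect 0 u v = 0 := by
  simp [conformalDefect, mixedLogDeriv]

lemma conformalDefect_sub_comm (x y u v : E) :
    conformalDefect (y - x) v u = conformalDefect (x - y) u v := by
  rw [conformalDefect, conformalDefect, mixedLogDeriv_comm, ← neg_sub x y, mixedLogDeriv_neg,
    norm_neg, mul_comm ‖v‖]

lemma conformalDefect_smul_smul (w u v : E) {a b : ℝ} (ha : 0 ≤ a) (hb : 0 ≤ b) :
    conformalDefect w (a • u) (b • v) = a * b * conformalDefect w u v := by
  rw [conformalDefect, conformalDefect, mixedLogDeriv_smul_smul, norm_smul_of_nonneg ha,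
    norm_smul_of_nonneg hb]
  ring

lemma conformalDefect_eq_norm_sub_reflection_sq (w : E) {u v : E} (hu : ‖u‖ = 1) (hv : ‖v‖ = 1) :
    conformalDefect w u v = ‖u - (ℝ ∙ w).reflection v‖ ^ 2 / (2 * ‖w‖ ^ 2) := by
  rw [conformalDefect, mixedLogDeriv_eq_inner_reflection, norm_sub_sq_real,
    LinearIsometryEquiv.norm_map, hu, hv]
  ring

lemma norm_norm_smul_sub_sq (w : E) {u : E} (hu : ‖u‖ = 1) :
    ‖‖w‖ • u - w‖ ^ 2 = 2 * ‖w‖ * (‖w‖ - ⟪u, w⟫) := by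
  rw [norm_sub_sq_real, norm_smul, norm_norm, hu, real_inner_smul_left]
  ring

lemma norm_sq_mul_norm_sub_reflection_sq_le (w : E) {u v : E} (hu : ‖u‖ = 1) (hv : ‖v‖ = 1) :
    ‖w‖ ^ 2 * ‖u - (ℝ ∙ w).reflection v‖ ^ 2 ≤
      4 * ‖w‖ * (‖w‖ - ⟪u, w⟫) + 4 * ‖w‖ * (‖w‖ - ⟪v, w⟫) := by
  have hfix : (ℝ ∙ w).reflection w = w :=
    Submodule.reflection_mem_subspace_eq_self (Submodule.mem_span_singleton_self w)
  have hsplit : ‖w‖ • (u - (ℝ ∙ w).reflection v) =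
      (‖w‖ • u - w) - (ℝ ∙ w).reflection (‖w‖ • v - w) := by
    rw [map_sub, map_smul, hfix, smul_sub]
    abel
  have htri := norm_sub_le (‖w‖ • u - w) ((ℝ ∙ w).reflection (‖w‖ • v - w))
  rw [← hsplit, norm_smul, norm_norm, LinearIsometryEquiv.norm_map] at htri
  calc ‖w‖ ^ 2 * ‖u - (ℝ ∙ w).reflection v‖ ^ 2
      = (‖w‖ * ‖u - (ℝ ∙ w).reflection v‖) ^ 2 := (mul_pow ..).symm
    _ ≤ (‖‖w‖ • u - w‖ + ‖‖w‖ • v - w‖) ^ 2 := by gcongr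
    _ ≤ 2 * (‖‖w‖ • u - w‖ ^ 2 + ‖‖w‖ • v - w‖ ^ 2) := add_sq_le
    _ = _ := by rw [norm_norm_smul_sub_sq w hu, norm_norm_smul_sub_sq w hv]; ring

lemma abs_conformalDefect_le {C c h : ℝ} {u v w : E} (hu : ‖u‖ = 1) (hv : ‖v‖ = 1) (hc : 0 < c)
    (hh : 0 < h) (hlu : h - C * h ^ 3 ≤ ⟪u, w⟫) (hlv : h - C * h ^ 3 ≤ ⟪v, w⟫) (hw : ‖w‖ ≤ h)
    (hcw : c * h ≤ ‖w‖) : |conformalDefect w u v| ≤ 4 * C / c ^ 4 := by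
  have hw0 : 0 < ‖w‖ := lt_of_lt_of_le (by positivity) hcw
  have hgap : ∀ z : E, ‖z‖ = 1 → h - C * h ^ 3 ≤ ⟪z, w⟫ → ‖w‖ * (‖w‖ - ⟪z, w⟫) ≤ C * h ^ 4 := by
    intro z hz hlz
    have hzw : ⟪z, w⟫ ≤ ‖w‖ := by simpa [hz] using real_inner_le_norm z w
    calc ‖w‖ * (‖w‖ - ⟪z, w⟫) ≤ h * (C * h ^ 3) := by gcongr; linarith
      _ = C * h ^ 4 := by ring
  have hdefect : ‖w‖ ^ 2 * ‖u - (ℝ ∙ w).reflection v‖ ^ 2 ≤ 8 * (C * h ^ 4) := by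
    linarith [norm_sq_mul_norm_sub_reflection_sq_le w hu hv, hgap u hu hlu, hgap v hv hlv]
  rw [conformalDefect_eq_norm_sub_reflection_sq w hu hv, abs_of_nonneg (by positivity)]
  calc ‖u - (ℝ ∙ w).reflection v‖ ^ 2 / (2 * ‖w‖ ^ 2)
      = ‖w‖ ^ 2 * ‖u - (ℝ ∙ w).reflection v‖ ^ 2 / (2 * ‖w‖ ^ 4) := by field_simp
    _ ≤ 8 * (C * h ^ 4) / (2 * (c * h) ^ 4) := by
        gcongr
        exact (mul_nonneg (sq_nonneg _) (sq_nonneg _)).trans hdefect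
    _ = 4 * C / c ^ 4 := by field_simp; ring

end ConformalDefect

section RealEstimates

variable {C c h δ q : ℝ}

lemma abs_one_div_sq_sub_one_div_sq_le (hc : 0 < c) (hh : 0 < h) (hl : h - C * h ^ 3 ≤ δ)
    (hδ : δ ≤ h) (hcδ : c * h ≤ δ) : |1 / δ ^ 2 - 1 / h ^ 2| ≤ 2 * C / c ^ 2 := by
  have hδ0 : 0 < δ := lt_of_lt_of_le (by positivity) hcδ
  have hgap : (h - δ) * (h + δ) ≤ C * h ^ 3 * (2 * h) := by gcongr <;> linarith
  have hnum : 0 ≤ (h - δ) * (h + δ) := mul_nonneg (by linarith) (by linarith)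
  calc |1 / δ ^ 2 - 1 / h ^ 2| = (h - δ) * (h + δ) / (δ ^ 2 * h ^ 2) := by
        rw [show 1 / δ ^ 2 - 1 / h ^ 2 = (h - δ) * (h + δ) / (δ ^ 2 * h ^ 2) by field_simp; ring,
          abs_of_nonneg (by positivity)]
    _ ≤ C * h ^ 3 * (2 * h) / ((c * h) ^ 2 * h ^ 2) := by gcongr; exact hnum.trans hgap
    _ = 2 * C / c ^ 2 := by field_simp

lemma abs_one_div_sub_div_sq_le (hc : 0 < c) (hh : h ≠ 0) (hq : |q - h| ≤ C * |h| ^ 3)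
    (hqδ : |q| ≤ δ) (hδ : δ ≤ |h|) (hcδ : c * |h| ≤ δ) :
    |1 / h - q / δ ^ 2| ≤ 3 * C / c ^ 2 * |h| := by
  have hh0 : 0 < |h| := abs_pos.2 hh
  have hδ0 : 0 < δ := lt_of_lt_of_le (by positivity) hcδ
  have hgap : |h| - δ ≤ C * |h| ^ 3 := by
    linarith [abs_sub_abs_le_abs_sub h q, abs_sub_comm h q]
  have hnum : |δ ^ 2 - h * q| ≤ 3 * C * |h| ^ 4 := by
    calc |δ ^ 2 - h * q| = |h * (h - q) - (|h| - δ) * (|h| + δ)| := by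
          congr 1; linear_combination sq_abs h
      _ ≤ |h * (h - q)| + |(|h| - δ) * (|h| + δ)| := abs_sub _ _
      _ = |h| * |q - h| + (|h| - δ) * (|h| + δ) := by
          rw [abs_mul, abs_sub_comm h,
            abs_of_nonneg (mul_nonneg (sub_nonneg.2 hδ) (add_pos hh0 hδ0).le)]
      _ ≤ |h| * (C * |h| ^ 3) + C * |h| ^ 3 * (2 * |h|) := by gcongr <;> linarith
      _ = 3 * C * |h| ^ 4 := by ring
  calc |1 / h - q / δ ^ 2| = |δ ^ 2 - h * q| / (|h| * δ ^ 2) := by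
        rw [← abs_of_pos (show 0 < δ ^ 2 by positivity), ← abs_mul, ← abs_div,
          abs_of_pos (show 0 < δ ^ 2 by positivity)]
        congr 1; field_simp
    _ ≤ 3 * C * |h| ^ 4 / (|h| * (c * |h|) ^ 2) := by
        gcongr; exact (abs_nonneg _).trans hnum
    _ = 3 * C / c ^ 2 * |h| := by field_simp

end RealEstimates

section ComplexCoordinates

open Module

variable {E : Type*} [NormedAddCommGroup E] [InnerProductSpace ℝ E]

lemma exists_norm_eq_one_inner_eq_zero (hE : 2 < finrank ℝ E) (p q : E) :
    ∃ n : E, ‖n‖ = 1 ∧ ⟪p, n⟫ = 0 ∧ ⟪q, n⟫ = 0 := by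
  have : FiniteDimensional ℝ E := .of_finrank_pos (by lia)
  have hker : LinearMap.ker ((innerₛₗ ℝ p).prod (innerₛₗ ℝ q)) ≠ ⊥ :=
    LinearMap.ker_ne_bot_of_finrank_lt (by simpa using hE)
  obtain ⟨n, hn, hn0⟩ := Submodule.exists_mem_ne_zero_of_ne_bot hker
  have hpq : ⟪p, n⟫ = 0 ∧ ⟪q, n⟫ = 0 := by simpa using hn
  exact ⟨‖n‖⁻¹ • n, norm_smul_inv_norm (𝕜 := ℝ) hn0, by simp [real_inner_smul_right, hpq.1],
    by simp [real_inner_smul_right, hpq.2]⟩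

lemma re_mul_div_sq (w u v : ℂ) : (u * v / w ^ 2).re = mixedLogDeriv w u v := by
  have hw : ‖w‖ ^ 2 = w.re ^ 2 + w.im ^ 2 := by
    rw [← Complex.normSq_eq_norm_sq, Complex.normSq_apply]; ring
  rcases eq_or_ne w 0 with rfl | hw0
  · simp [mixedLogDeriv]
  have hne : ‖w‖ ≠ 0 := norm_ne_zero_iff.2 hw0
  rw [Complex.div_re, map_pow, Complex.normSq_eq_norm_sq, mixedLogDeriv]
  simp only [Complex.inner, Complex.mul_re, Complex.mul_im, Complex.conj_re,
    Complex.conj_im, pow_two w]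
  field_simp
  rw [hw]
  ring

/-- The coordinates of a vector with respect to `e₁` and `e₂`, as a complex number. -/
def complexCoord (e₁ e₂ : E) : E →L[ℝ] ℂ :=
  (innerSL ℝ e₁).smulRight (1 : ℂ) + (innerSL ℝ e₂).smulRight Complex.I

lemma complexCoord_apply (e₁ e₂ z : E) : complexCoord e₁ e₂ z = ⟨⟪e₁, z⟫, ⟪e₂, z⟫⟩ := by
  apply Complex.ext <;> simp [complexCoord]

lemma complexCoord_neg_right (e₁ e₂ z : E) :
    complexCoord e₁ (-e₂) z = starRingEnd ℂ (complexCoord e₁ e₂ z) := by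
  rw [complexCoord_apply, complexCoord_apply]
  apply Complex.ext <;> simp

lemma orthonormal_pair_normalized {e₁ e₂ n : E} (h₁ : ‖e₁‖ = 1) (h₂ : ‖e₂‖ = 1)
    (h₁₂ : ⟪e₁, e₂⟫ = 0) (hn : n ≠ 0) (hn₁ : ⟪n, e₁⟫ = 0) (hn₂ : ⟪n, e₂⟫ = 0) :
    Orthonormal ℝ ![e₁, e₂, ‖n‖⁻¹ • n] := by
  have hn' : ‖n‖ ≠ 0 := norm_ne_zero_iff.2 hn
  rw [orthonormal_iff_ite]
  intro i j
  fin_cases i <;> fin_cases j <;>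
    simp [h₁, h₂, h₁₂, hn₁, hn₂, real_inner_comm e₁ e₂, real_inner_comm n e₁, real_inner_comm n e₂,
      inner_smul_left, inner_smul_right, norm_smul, hn']

lemma inner_complexCoord (hE : finrank ℝ E = 3) {e₁ e₂ n : E} (h₁ : ‖e₁‖ = 1) (h₂ : ‖e₂‖ = 1)
    (h₁₂ : ⟪e₁, e₂⟫ = 0) (hn : n ≠ 0) (hn₁ : ⟪n, e₁⟫ = 0) (hn₂ : ⟪n, e₂⟫ = 0) {z : E}
    (hz : ⟪n, z⟫ = 0) (z' : E) : ⟪complexCoord e₁ e₂ z, complexCoord e₁ e₂ z'⟫ = ⟪z, z'⟫ := by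
  have : FiniteDimensional ℝ E := .of_finrank_pos (by lia)
  have ho := orthonormal_pair_normalized h₁ h₂ h₁₂ hn hn₁ hn₂
  have hspan : ⊤ ≤ Submodule.span ℝ (Set.range ![e₁, e₂, ‖n‖⁻¹ • n]) :=
    (ho.linearIndependent.span_eq_top_of_card_eq_finrank' (by simp [hE])).ge
  rw [← (OrthonormalBasis.mk ho hspan).sum_inner_mul_inner z z']
  simp [complexCoord_apply, Complex.inner, Fin.sum_univ_three, inner_smul_right,
    real_inner_comm n z, real_inner_comm e₁ z, real_inner_comm e₂ z, hz,
    mul_comm]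

end ComplexCoordinates

namespace TwoSphere

variable (S : TwoSphere)

lemma mem_tangentSpace {v w : E3} : w ∈ S.tangentSpace v ↔ ⟪S.a • v + S.b, w⟫ = 0 :=
  Submodule.mem_orthogonal_singleton_iff_inner_right

lemma norm_normal_sq {v : E3} (hv : v ∈ S.carrier) :
    ‖S.a • v + S.b‖ ^ 2 = ‖S.b‖ ^ 2 - S.a * S.c := by
  have hv : S.a * ‖v‖ ^ 2 + 2 * ⟪S.b, v⟫ + S.c = 0 := hv
  rw [norm_add_sq_real, norm_smul, mul_pow, Real.norm_eq_abs, sq_abs, real_inner_smul_left,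
    real_inner_comm S.b]
  linear_combination S.a * hv

lemma normal_ne_zero {v : E3} (hv : v ∈ S.carrier) : S.a • v + S.b ≠ 0 := by
  have hsq : 0 < ‖S.a • v + S.b‖ ^ 2 := S.norm_normal_sq hv ▸ S.nondegenerate
  intro h
  simp [h] at hsq

lemma mem_carrier_iff {x y : E3} (hx : x ∈ S.carrier) :
    y ∈ S.carrier ↔ S.a * ‖y - x‖ ^ 2 + 2 * ⟪S.a • x + S.b, y - x⟫ = 0 := by
  have hx : S.a * ‖x‖ ^ 2 + 2 * ⟪S.b, x⟫ + S.c = 0 := hx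
  change S.a * ‖y‖ ^ 2 + 2 * ⟪S.b, y⟫ + S.c = 0 ↔ _
  rw [norm_sub_sq_real, inner_add_left, inner_sub_right, inner_sub_right, real_inner_smul_left,
    real_inner_smul_left, real_inner_self_eq_norm_sq, real_inner_comm x y]
  constructor <;> intro h
  · linear_combination h - hx
  · linear_combination h + hx

/-- The sphere through `x` with normal vector `n` there, and with curvature governed by the
leading coefficient `a` of its equation. -/
def ofPointNormal (x : E3) {n : E3} (hn : n ≠ 0) (a : ℝ) : TwoSphere where
  a := a
  b := n - a • x
  c := a * ‖x‖ ^ 2 - 2 * ⟪n, x⟫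
  nondegenerate := by
    have hsq : ‖n - a • x‖ ^ 2 - a * (a * ‖x‖ ^ 2 - 2 * ⟪n, x⟫) = ‖n‖ ^ 2 := by
      rw [norm_sub_sq_real, norm_smul, mul_pow, Real.norm_eq_abs, sq_abs, real_inner_smul_right]
      ring
    rw [hsq]
    positivity

lemma mem_carrier_ofPointNormal (x : E3) {n : E3} (hn : n ≠ 0) (a : ℝ) :
    x ∈ (ofPointNormal x hn a).carrier := by
  change a * ‖x‖ ^ 2 + 2 * ⟪n - a • x, x⟫ + (a * ‖x‖ ^ 2 - 2 * ⟪n, x⟫) = 0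
  rw [inner_sub_left, real_inner_smul_left, real_inner_self_eq_norm_sq]
  ring

lemma normal_ofPointNormal (x y : E3) {n : E3} (hn : n ≠ 0) (a : ℝ) :
    (ofPointNormal x hn a).a • y + (ofPointNormal x hn a).b = n + a • (y - x) := by
  simp only [ofPointNormal]
  module

/-- Among the spheres through `x` with normal `n` there is one through `y`, and its normal at `y`
is the mirror image of `n` in the bisector of `x` and `y`. So `n` has to be orthogonal to `u` and
to the mirror image of `v`. -/
lemma exists_tangent {x y : E3} (hxy : x ≠ y) (u v : E3) :
    ∃ S : TwoSphere, (x ∈ S.carrier ∧ u ∈ S.tangentSpace x) ∧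
      y ∈ S.carrier ∧ v ∈ S.tangentSpace y := by
  obtain ⟨n, hn, hun, hvn⟩ := exists_norm_eq_one_inner_eq_zero (E := E3) (by simp) u
    ((ℝ ∙ (y - x)).reflection v)
  have hn0 : n ≠ 0 := norm_ne_zero_iff.1 (by simp [hn])
  have hw : ‖y - x‖ ≠ 0 := norm_ne_zero_iff.2 (sub_ne_zero.2 hxy.symm)
  set a := -2 * ⟪n, y - x⟫ / ‖y - x‖ ^ 2 with ha
  refine ⟨ofPointNormal x hn0 a, ⟨mem_carrier_ofPointNormal x hn0 a, ?_⟩, ?_, ?_⟩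
  · rwa [mem_tangentSpace, normal_ofPointNormal, sub_self, smul_zero, add_zero, real_inner_comm]
  · rw [mem_carrier_iff _ (mem_carrier_ofPointNormal x hn0 a), normal_ofPointNormal, sub_self,
      smul_zero, add_zero]
    change a * ‖y - x‖ ^ 2 + 2 * ⟪n, y - x⟫ = 0
    rw [ha]
    field_simp
    ring
  · rw [Submodule.reflection_singleton_apply, inner_sub_left, two_smul, inner_add_left,
      real_inner_smul_left, RCLike.ofReal_real_eq_id, id_eq, real_inner_comm n v] at hvn
    rw [mem_tangentSpace, normal_ofPointNormal, inner_add_left, real_inner_smul_left, ha,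
      real_inner_comm (y - x) n]
    linear_combination -hvn

/-- The inversion with centre `x` takes the sphere to a plane parallel to its tangent plane at
`x`, and the point is found in that plane, off the line that corresponds to `y`. -/
lemma exists_mem_ne {x : E3} (hx : x ∈ S.carrier) (y : E3) :
    ∃ N ∈ S.carrier, N ≠ x ∧ N ≠ y := by
  set n := S.a • x + S.b with hn
  have hn0 : ‖n‖ ≠ 0 := norm_ne_zero_iff.2 (S.normal_ne_zero hx)
  obtain ⟨p, hp, hnp, hyp⟩ := exists_norm_eq_one_inner_eq_zero (E := E3) (by simp) n (y - x)
  set z := p - (S.a / (2 * ‖n‖ ^ 2)) • n with hz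
  have hpz : ⟪z, p⟫ = 1 := by
    rw [hz, inner_sub_left, real_inner_smul_left, hnp, real_inner_self_eq_norm_sq, hp]
    ring
  have hnz : ⟪n, z⟫ = -S.a / 2 := by
    rw [hz, inner_sub_right, real_inner_smul_right, hnp, real_inner_self_eq_norm_sq]
    field_simp
    ring
  have hz0 : ‖z‖ ≠ 0 := norm_ne_zero_iff.2 fun h => by simp [h] at hpz
  have hne : ∀ w : E3, ⟪w - x, p⟫ = 0 → x + (‖z‖ ^ 2)⁻¹ • z ≠ w := by
    rintro _ hw rfl
    rw [add_sub_cancel_left, real_inner_smul_left, hpz, mul_one] at hw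
    exact inv_ne_zero (pow_ne_zero 2 hz0) hw
  refine ⟨x + (‖z‖ ^ 2)⁻¹ • z, ?_, hne x (by simp), hne y hyp⟩
  rw [S.mem_carrier_iff hx, ← hn, add_sub_cancel_left, norm_smul, real_inner_smul_right, hnz,
    norm_inv, norm_pow, norm_norm]
  field_simp
  ring

end TwoSphere

namespace StereographicProjection

open EuclideanGeometry (inversion)

lemma exists_pole_eq {S : TwoSphere} {N : E3} (hN : N ∈ S.carrier) :
    ∃ p : StereographicProjection S, p.pole = N := by
  obtain ⟨e₁, h₁, hn₁, -⟩ := exists_norm_eq_one_inner_eq_zero (E := E3) (by simp) (S.a • N + S.b) 0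
  obtain ⟨e₂, h₂, hn₂, h₁₂⟩ :=
    exists_norm_eq_one_inner_eq_zero (E := E3) (by simp) (S.a • N + S.b) e₁
  exact ⟨⟨N, hN, 1, one_pos, e₁, e₂, S.mem_tangentSpace.2 hn₁, S.mem_tangentSpace.2 hn₂, h₁, h₂,
    h₁₂⟩, rfl⟩

variable {S : TwoSphere} (p : StereographicProjection S)

/-- The stereographic projection from the same point with the opposite orientation. -/
def conj : StereographicProjection S where
  __ := p
  e₂ := -p.e₂
  e₂_mem := neg_mem p.e₂_mem
  norm_e₂ := by rw [norm_neg, p.norm_e₂]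
  orthogonal := by rw [inner_neg_right, p.orthogonal, neg_zero]

lemma proj_sub_proj (x y : E3) :
    p.proj x - p.proj y =
      complexCoord p.e₁ p.e₂ (inversion p.pole p.radius x - inversion p.pole p.radius y) := by
  rw [map_sub, complexCoord_apply, complexCoord_apply]
  rfl

lemma dproj_apply {x : E3} (hx : x ≠ p.pole) (u : E3) :
    p.dproj x u = complexCoord p.e₁ p.e₂ (fderiv ℝ (inversion p.pole p.radius) x u) := by
  have hproj : p.proj = complexCoord p.e₁ p.e₂ ∘ inversion p.pole p.radius :=
    funext fun v => (complexCoord_apply _ _ _).symm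
  have hι := (EuclideanGeometry.hasFDerivAt_inversion (R := p.radius) hx).differentiableAt
  rw [dproj, hproj, ((complexCoord p.e₁ p.e₂).hasFDerivAt.comp x hι.hasFDerivAt).fderiv]
  rfl

lemma inner_normal_inversion_sub {x y : E3} (hxS : x ∈ S.carrier) (hx : x ≠ p.pole)
    (hyS : y ∈ S.carrier) (hy : y ≠ p.pole) :
    ⟪S.a • p.pole + S.b, inversion p.pole p.radius x - inversion p.pole p.radius y⟫ = 0 := by
  have hX : ‖x - p.pole‖ ≠ 0 := norm_ne_zero_iff.2 (sub_ne_zero.2 hx)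
  have hY : ‖y - p.pole‖ ≠ 0 := norm_ne_zero_iff.2 (sub_ne_zero.2 hy)
  have hxn := (S.mem_carrier_iff p.pole_mem).1 hxS
  have hyn := (S.mem_carrier_iff p.pole_mem).1 hyS
  rw [inversion_sub_inversion, inner_sub_right, real_inner_smul_right, real_inner_smul_right]
  field_simp
  linear_combination p.radius ^ 2 / 2 * (‖y - p.pole‖ ^ 2 * hxn - ‖x - p.pole‖ ^ 2 * hyn)

lemma inner_normal_fderiv_inversion {x u : E3} (hxS : x ∈ S.carrier) (hx : x ≠ p.pole)
    (hu : u ∈ S.tangentSpace x) :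
    ⟪S.a • p.pole + S.b, fderiv ℝ (inversion p.pole p.radius) x u⟫ = 0 := by
  have hX : ‖x - p.pole‖ ≠ 0 := norm_ne_zero_iff.2 (sub_ne_zero.2 hx)
  have hxn := (S.mem_carrier_iff p.pole_mem).1 hxS
  rw [S.mem_tangentSpace,
    show S.a • x + S.b = (S.a • p.pole + S.b) + S.a • (x - p.pole) by module, inner_add_left,
    real_inner_smul_left, real_inner_comm u (x - p.pole)] at hu
  rw [fderiv_inversion_apply p.radius hx, real_inner_smul_right, inner_sub_right,
    real_inner_smul_right]
  refine mul_eq_zero_of_right _ ?_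
  field_simp
  linear_combination ‖x - p.pole‖ ^ 2 * hu - ⟪u, x - p.pole⟫ * hxn

lemma inner_complexCoord {z : E3} (hz : ⟪S.a • p.pole + S.b, z⟫ = 0) (z' : E3) :
    ⟪complexCoord p.e₁ p.e₂ z, complexCoord p.e₁ p.e₂ z'⟫ = ⟪z, z'⟫ :=
  _root_.inner_complexCoord (by simp) p.norm_e₁ p.norm_e₂ p.orthogonal
    (S.normal_ne_zero p.pole_mem) (S.mem_tangentSpace.1 p.e₁_mem) (S.mem_tangentSpace.1 p.e₂_mem)
    hz z'

lemma norm_complexCoord {z : E3} (hz : ⟪S.a • p.pole + S.b, z⟫ = 0) :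
    ‖complexCoord p.e₁ p.e₂ z‖ = ‖z‖ := by
  rw [← sq_eq_sq₀ (norm_nonneg _) (norm_nonneg _), ← real_inner_self_eq_norm_sq,
    p.inner_complexCoord hz, real_inner_self_eq_norm_sq]

lemma norm_proj_sub_proj {x y : E3} (hxS : x ∈ S.carrier) (hx : x ≠ p.pole)
    (hyS : y ∈ S.carrier) (hy : y ≠ p.pole) :
    ‖p.proj x - p.proj y‖ = p.radius ^ 2 / (‖x - p.pole‖ * ‖y - p.pole‖) * ‖x - y‖ := by
  rw [p.proj_sub_proj, p.norm_complexCoord (p.inner_normal_inversion_sub hxS hx hyS hy),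
    ← dist_eq_norm, EuclideanGeometry.dist_inversion_inversion hx hy, dist_eq_norm, dist_eq_norm,
    dist_eq_norm]

lemma proj_sub_ne_zero {x y : E3} (hxS : x ∈ S.carrier) (hx : x ≠ p.pole)
    (hyS : y ∈ S.carrier) (hy : y ≠ p.pole) (hxy : x ≠ y) : p.proj x - p.proj y ≠ 0 := by
  have hr := p.radius_pos
  have hX : 0 < ‖x - p.pole‖ := norm_sub_pos_iff.2 hx
  have hY : 0 < ‖y - p.pole‖ := norm_sub_pos_iff.2 hy
  have hXY : 0 < ‖x - y‖ := norm_sub_pos_iff.2 hxy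
  rw [← norm_pos_iff, p.norm_proj_sub_proj hxS hx hyS hy]
  positivity

lemma norm_dproj_apply {x u : E3} (hxS : x ∈ S.carrier) (hx : x ≠ p.pole)
    (hu : u ∈ S.tangentSpace x) : ‖p.dproj x u‖ = (p.radius / ‖x - p.pole‖) ^ 2 * ‖u‖ := by
  rw [p.dproj_apply hx, p.norm_complexCoord (p.inner_normal_fderiv_inversion hxS hx hu),
    norm_fderiv_inversion_apply p.radius hx]

/-- The coefficient `dx̃ dỹ / (x̃ - ỹ)²` of the leading term of the cross ratio, computed with the
projection `p` for the directions `u` at `x` and `v` at `y`. -/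
def crossRatioCoeff (x y u v : E3) : ℂ :=
  p.dproj x u * p.dproj y v / (p.proj x - p.proj y) ^ 2

lemma norm_crossRatioCoeff {x y u v : E3} (hxS : x ∈ S.carrier) (hx : x ≠ p.pole)
    (hyS : y ∈ S.carrier) (hy : y ≠ p.pole) (hu : u ∈ S.tangentSpace x)
    (hv : v ∈ S.tangentSpace y) :
    ‖p.crossRatioCoeff x y u v‖ = ‖u‖ * ‖v‖ / ‖x - y‖ ^ 2 := by
  have hr := p.radius_pos.ne'
  have hX : ‖x - p.pole‖ ≠ 0 := norm_ne_zero_iff.2 (sub_ne_zero.2 hx)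
  have hY : ‖y - p.pole‖ ≠ 0 := norm_ne_zero_iff.2 (sub_ne_zero.2 hy)
  rw [crossRatioCoeff, norm_div, norm_mul, norm_pow, p.norm_proj_sub_proj hxS hx hyS hy,
    p.norm_dproj_apply hxS hx hu, p.norm_dproj_apply hyS hy hv]
  field_simp

lemma re_crossRatioCoeff {x y u v : E3} (hxS : x ∈ S.carrier) (hx : x ≠ p.pole)
    (hyS : y ∈ S.carrier) (hy : y ≠ p.pole) (hxy : x ≠ y) (hu : u ∈ S.tangentSpace x)
    (hv : v ∈ S.tangentSpace y) :
    (p.crossRatioCoeff x y u v).re = mixedLogDeriv (x - y) u v := by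
  have hw := p.inner_normal_inversion_sub hxS hx hyS hy
  have hu := p.inner_normal_fderiv_inversion hxS hx hu
  have hv := p.inner_normal_fderiv_inversion hyS hy hv
  rw [crossRatioCoeff, re_mul_div_sq, p.proj_sub_proj, p.dproj_apply hx, p.dproj_apply hy,
    ← mixedLogDeriv_inversion p.radius_pos.ne' hx hy hxy, mixedLogDeriv, mixedLogDeriv,
    p.norm_complexCoord hw, p.inner_complexCoord hu, p.inner_complexCoord hv,
    p.inner_complexCoord hu]

lemma crossRatioCoeff_conj {x y : E3} (hx : x ≠ p.pole) (hy : y ≠ p.pole) (u v : E3) :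
    p.conj.crossRatioCoeff x y u v = starRingEnd ℂ (p.crossRatioCoeff x y u v) := by
  rw [crossRatioCoeff, crossRatioCoeff, p.conj.dproj_apply hx, p.conj.dproj_apply hy,
    p.conj.proj_sub_proj, p.dproj_apply hx, p.dproj_apply hy, p.proj_sub_proj]
  simp only [conj, complexCoord_neg_right, map_div₀, map_mul, map_pow]

end StereographicProjection

section CrossRatio

lemma crossRatio_add_smul_div {a b : ℝ} (ha : a ≠ 0) (hb : b ≠ 0) (X Y U V : ℂ) :
    crossRatio (X + a • U) Y X (Y + b • V) / ((a * b : ℝ) : ℂ) =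
      U * V / ((X + a • U - (Y + b • V)) * (X - Y)) := by
  have ha : (a : ℂ) ≠ 0 := Complex.ofReal_ne_zero.2 ha
  have hb : (b : ℂ) ≠ 0 := Complex.ofReal_ne_zero.2 hb
  rw [crossRatio, add_sub_cancel_left, sub_add_cancel_left, ← neg_sub X Y, neg_div_neg_eq,
    div_div_div_eq, div_div, Complex.real_smul, Complex.real_smul, Complex.ofReal_mul,
    ← mul_div_mul_left (U * V) _ (mul_ne_zero ha hb)]
  ring

lemma tendsto_crossRatio_div {X Y : ℂ} (h : X - Y ≠ 0) (U V : ℂ) :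
    Tendsto
      (fun d : ℝ × ℝ => crossRatio (X + d.1 • U) Y X (Y + d.2 • V) / ((d.1 * d.2 : ℝ) : ℂ))
      (𝓝[≠] (0 : ℝ) ×ˢ 𝓝[≠] (0 : ℝ)) (𝓝 (U * V / (X - Y) ^ 2)) := by
  have hcont : ContinuousAt
      (fun d : ℝ × ℝ => U * V / ((X + d.1 • U - (Y + d.2 • V)) * (X - Y))) (0, 0) :=
    .div (by fun_prop) (by fun_prop) (by simpa using h)
  have hlim := hcont.tendsto.mono_left
    ((Filter.prod_mono (nhdsWithin_le_nhds (s := {0}ᶜ)) (nhdsWithin_le_nhds (s := {0}ᶜ))).trans_eq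
      nhds_prod_eq.symm)
  simp only [zero_smul, add_zero, ← pow_two] at hlim
  have hne : ∀ᶠ d : ℝ × ℝ in 𝓝[≠] (0 : ℝ) ×ˢ 𝓝[≠] (0 : ℝ), d.1 ≠ 0 ∧ d.2 ≠ 0 :=
    Eventually.prod_mk self_mem_nhdsWithin self_mem_nhdsWithin
  refine hlim.congr' ?_
  filter_upwards [hne] with d hd
  exact (crossRatio_add_smul_div hd.1 hd.2 X Y U V).symm

variable {K : Knot} {s t : ℝ}

lemma IsInfinitesimalCrossRatio.exists_eq_crossRatioCoeff {ω : ℂ}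
    (h : IsInfinitesimalCrossRatio K s t ω) (hst : K.toFun s ≠ K.toFun t) :
    ∃ (S : TwoSphere) (p : StereographicProjection S),
      S.IsTangentAt K s ∧ S.IsTangentAt K t ∧ K.toFun s ≠ p.pole ∧ K.toFun t ≠ p.pole ∧
      ω = p.crossRatioCoeff (K.toFun s) (K.toFun t) (K.velocity s) (K.velocity t) := by
  obtain ⟨-, S, p, hs, ht, hps, hpt, hlim⟩ := h
  exact ⟨S, p, hs, ht, hps.symm, hpt.symm, tendsto_nhds_unique hlim
    (tendsto_crossRatio_div (p.proj_sub_ne_zero hs.1 hps.symm ht.1 hpt.symm hst) _ _)⟩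

lemma IsInfinitesimalCrossRatio.norm_eq {ω : ℂ} (h : IsInfinitesimalCrossRatio K s t ω)
    (hst : K.toFun s ≠ K.toFun t) :
    ‖ω‖ = ‖K.velocity s‖ * ‖K.velocity t‖ / ‖K.toFun s - K.toFun t‖ ^ 2 := by
  obtain ⟨S, p, hs, ht, hps, hpt, rfl⟩ := h.exists_eq_crossRatioCoeff hst
  exact p.norm_crossRatioCoeff hs.1 hps ht.1 hpt hs.2 ht.2

lemma IsInfinitesimalCrossRatio.re_eq {ω : ℂ} (h : IsInfinitesimalCrossRatio K s t ω)
    (hst : K.toFun s ≠ K.toFun t) :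
    ω.re = mixedLogDeriv (K.toFun s - K.toFun t) (K.velocity s) (K.velocity t) := by
  obtain ⟨S, p, hs, ht, hps, hpt, rfl⟩ := h.exists_eq_crossRatioCoeff hst
  exact p.re_crossRatioCoeff hs.1 hps ht.1 hpt hst hs.2 ht.2

lemma exists_isInfinitesimalCrossRatio (hst : K.toFun s ≠ K.toFun t) :
    ∃ ω, IsInfinitesimalCrossRatio K s t ω := by
  obtain ⟨S, hs, ht⟩ := TwoSphere.exists_tangent hst (K.velocity s) (K.velocity t)
  obtain ⟨N, hN, hNs, hNt⟩ := S.exists_mem_ne hs.1 (K.toFun t)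
  obtain ⟨p, rfl⟩ := StereographicProjection.exists_pole_eq hN
  have hlim : ∀ q : StereographicProjection S, q.pole = p.pole →
      0 ≤ (q.crossRatioCoeff (K.toFun s) (K.toFun t) (K.velocity s) (K.velocity t)).im →
      ∃ ω, IsInfinitesimalCrossRatio K s t ω := fun q hq him =>
    ⟨_, him, S, q, hs, ht, hq ▸ hNs, hq ▸ hNt, tendsto_crossRatio_div
      (q.proj_sub_ne_zero hs.1 (hq ▸ hNs.symm) ht.1 (hq ▸ hNt.symm) hst) _ _⟩
  rcases le_total 0 (p.crossRatioCoeff (K.toFun s) (K.toFun t) (K.velocity s) (K.velocity t)).im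
    with him | him
  · exact hlim p rfl him
  · refine hlim p.conj rfl ?_
    rw [p.crossRatioCoeff_conj hNs.symm hNt.symm, Complex.conj_im]
    linarith

lemma complex_eq_of_norm_eq_of_re_eq {z w : ℂ} (hnorm : ‖z‖ = ‖w‖) (hre : z.re = w.re)
    (hz : 0 ≤ z.im) (hw : 0 ≤ w.im) : z = w := by
  have hsq : z.im ^ 2 = w.im ^ 2 := by
    rw [← Complex.sq_norm_sub_sq_re, ← Complex.sq_norm_sub_sq_re, hnorm, hre]
  exact Complex.ext hre ((sq_eq_sq₀ hz hw).1 hsq)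

lemma existsUnique_isInfinitesimalCrossRatio (hst : K.toFun s ≠ K.toFun t) :
    ∃! ω, IsInfinitesimalCrossRatio K s t ω := by
  obtain ⟨ω, hω⟩ := exists_isInfinitesimalCrossRatio hst
  refine ⟨ω, hω, fun ω' hω' => complex_eq_of_norm_eq_of_re_eq ?_ ?_ hω'.1 hω.1⟩
  · rw [hω'.norm_eq hst, hω.norm_eq hst]
  · rw [hω'.re_eq hst, hω.re_eq hst]

lemma crossRatioIntegrand_eq_conformalDefect (hst : K.toFun s ≠ K.toFun t) :
    crossRatioIntegrand K (s, t) =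
      conformalDefect (K.toFun s - K.toFun t) (K.velocity s) (K.velocity t) := by
  have hex := exists_isInfinitesimalCrossRatio hst
  have hω : IsInfinitesimalCrossRatio K s t (infinitesimalCrossRatio K s t) := by
    rw [infinitesimalCrossRatio, dif_pos hex]
    exact hex.choose_spec
  rw [crossRatioIntegrand, hω.norm_eq hst, hω.re_eq hst, conformalDefect]

end CrossRatio

namespace Knot

variable (K : Knot)

section ArcLength

lemma hasDerivAt_toFun (s : ℝ) : HasDerivAt K.toFun (K.velocity s) s :=
  (K.contDiff.differentiable (by norm_num) s).hasDerivAt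

lemma contDiff_velocity : ContDiff ℝ 1 K.velocity :=
  ((contDiff_succ_iff_deriv (n := 1)).1 K.contDiff).2.2

@[fun_prop]
lemma continuous_toFun : Continuous K.toFun := K.contDiff.continuous

@[fun_prop]
lemma continuous_velocity : Continuous K.velocity := K.contDiff_velocity.continuous

lemma speed_pos (s : ℝ) : 0 < ‖K.velocity s‖ := norm_pos_iff.2 (K.immersion s)

lemma velocity_periodic : Function.Periodic K.velocity 1 := fun s => by
  rw [velocity, ← deriv_comp_add_const, funext K.periodic]
  rfl

lemma toFun_ne {a b : ℝ} (hab : a ≠ b) (h : |a - b| < 1) : K.toFun a ≠ K.toFun b := by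
  intro hK
  have hfract : ∀ s, K.toFun (Int.fract s) = K.toFun s := fun s => by
    simpa using K.periodic.sub_zsmul_eq (x := s) ⌊s⌋
  rw [← hfract a, ← hfract b] at hK
  obtain ⟨z, hz⟩ := Int.fract_eq_fract.1 (K.injOn ⟨Int.fract_nonneg a, Int.fract_lt_one a⟩
    ⟨Int.fract_nonneg b, Int.fract_lt_one b⟩ hK)
  have hz0 : z = 0 := by
    rw [hz] at h
    exact Int.abs_lt_one_iff.1 (by exact_mod_cast h)
  exact hab (sub_eq_zero.1 (by simpa [hz0] using hz))

lemma speed_intervalIntegrable (a b : ℝ) :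
    IntervalIntegrable (fun s => ‖K.velocity s‖) volume a b :=
  K.continuous_velocity.norm.intervalIntegrable a b

lemma arcLength_self (a : ℝ) : K.arcLength a a = 0 := intervalIntegral.integral_same

lemma arcLength_add (a b c : ℝ) : K.arcLength a b + K.arcLength b c = K.arcLength a c :=
  intervalIntegral.integral_add_adjacent_intervals (K.speed_intervalIntegrable a b)
    (K.speed_intervalIntegrable b c)

lemma arcLength_symm (a b : ℝ) : K.arcLength b a = -K.arcLength a b :=
  intervalIntegral.integral_symm a b

lemma arcLength_pos {a b : ℝ} (h : a < b) : 0 < K.arcLength a b :=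
  intervalIntegral.intervalIntegral_pos_of_pos (K.speed_intervalIntegrable a b) K.speed_pos h

lemma arcLength_nonneg {a b : ℝ} (h : a ≤ b) : 0 ≤ K.arcLength a b :=
  intervalIntegral.integral_nonneg h fun _ _ => norm_nonneg _

lemma arcLength_ne_zero {a b : ℝ} (h : a ≠ b) : K.arcLength a b ≠ 0 := by
  rcases h.lt_or_gt with h | h
  · exact (K.arcLength_pos h).ne'
  · rw [K.arcLength_symm, neg_ne_zero]
    exact (K.arcLength_pos h).ne'

lemma abs_arcLength_mono {a b c d : ℝ} (hc : c ∈ uIcc a b) (hd : d ∈ uIcc a b) :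
    |K.arcLength c d| ≤ |K.arcLength a b| :=
  intervalIntegral.abs_integral_mono_interval
    (uIoc_subset_uIoc_of_uIcc_subset_uIcc (uIcc_subset_uIcc hc hd))
    (ae_of_all _ fun _ => norm_nonneg _) (K.speed_intervalIntegrable a b)

lemma arcLength_sub_intCast (a b : ℝ) (n : ℤ) : K.arcLength (a - n) (b - n) = K.arcLength a b := by
  rw [arcLength, ← intervalIntegral.integral_comp_sub_right, arcLength]
  congr! 3 with u
  simpa using K.velocity_periodic.sub_zsmul_eq (x := u) n

lemma arcLength_add_one (a : ℝ) : K.arcLength a (a + 1) = K.length := by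
  have hper : Function.Periodic (fun s => ‖K.velocity s‖) 1 := K.velocity_periodic.comp _
  simpa [length, arcLength] using hper.intervalIntegral_add_eq a 0

lemma length_pos : 0 < K.length := K.arcLength_pos one_pos

lemma arcLength_add_one_right (s t : ℝ) : K.arcLength t (s + 1) = K.length - K.arcLength s t := by
  rw [← K.arcLength_add_one s, ← K.arcLength_add s t (s + 1), add_sub_cancel_left]

lemma abs_sub_lt_one {a b : ℝ} (h : |K.arcLength a b| < K.length) : |a - b| < 1 := by
  wlog hab : a ≤ b generalizing a b
  · rw [abs_sub_comm]
    exact this (by rwa [K.arcLength_symm, abs_neg]) (le_of_not_ge hab)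
  by_contra! hle
  rw [abs_sub_comm, abs_of_nonneg (sub_nonneg.2 hab)] at hle
  have hrest : 0 ≤ K.arcLength (a + 1) b := K.arcLength_nonneg (by linarith)
  rw [← K.arcLength_add a (a + 1) b, K.arcLength_add_one] at h
  linarith [le_abs_self (K.length + K.arcLength (a + 1) b)]

lemma hasDerivAt_arcLength (a b : ℝ) : HasDerivAt (K.arcLength a) ‖K.velocity b‖ b :=
  intervalIntegral.integral_hasDerivAt_right (K.speed_intervalIntegrable a b)
    (K.continuous_velocity.norm.stronglyMeasurableAtFilter _ _)
    K.continuous_velocity.norm.continuousAt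

lemma continuous_arcLength_right (a : ℝ) : Continuous (K.arcLength a) :=
  continuous_iff_continuousAt.2 fun b => (K.hasDerivAt_arcLength a b).continuousAt

lemma continuous_arcLength : Continuous fun p : ℝ × ℝ => K.arcLength p.1 p.2 := by
  have hsub : ∀ p : ℝ × ℝ, K.arcLength p.1 p.2 = K.arcLength 0 p.2 - K.arcLength 0 p.1 := fun p =>
    eq_sub_of_add_eq' (K.arcLength_add 0 p.1 p.2)
  simp only [hsub]
  exact ((K.continuous_arcLength_right 0).comp continuous_snd).sub
    ((K.continuous_arcLength_right 0).comp continuous_fst)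

end ArcLength

section Chord

/-- The unit tangent vector. -/
def tangent (s : ℝ) : E3 := ‖K.velocity s‖⁻¹ • K.velocity s

lemma norm_tangent (s : ℝ) : ‖K.tangent s‖ = 1 := norm_smul_inv_norm (𝕜 := ℝ) (K.immersion s)

lemma speed_smul_tangent (s : ℝ) : ‖K.velocity s‖ • K.tangent s = K.velocity s :=
  smul_inv_smul₀ (K.speed_pos s).ne' _

lemma contDiff_tangent : ContDiff ℝ 1 K.tangent :=
  ((K.contDiff_velocity.norm ℝ K.immersion).inv fun s => (K.speed_pos s).ne').smul
    K.contDiff_velocity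

lemma tangent_periodic : Function.Periodic K.tangent 1 := fun s => by
  rw [tangent, K.velocity_periodic, tangent]

lemma exists_norm_deriv_tangent_le :
    ∃ C : ℝ, 0 ≤ C ∧ ∀ s, ‖deriv K.tangent s‖ ≤ C * ‖K.velocity s‖ := by
  have hper : Function.Periodic (fun s => ‖deriv K.tangent s‖ / ‖K.velocity s‖) 1 := fun s => by
    simp only [K.velocity_periodic s, ← deriv_comp_add_const, funext K.tangent_periodic]
  have hcont : Continuous fun s => ‖deriv K.tangent s‖ / ‖K.velocity s‖ :=
    (K.contDiff_tangent.continuous_deriv le_rfl).norm.div K.continuous_velocity.norm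
      fun s => (K.speed_pos s).ne'
  obtain ⟨C, hC⟩ := (hper.isBounded_of_continuous one_ne_zero hcont).bddAbove
  have hle : ∀ s, ‖deriv K.tangent s‖ / ‖K.velocity s‖ ≤ C := fun s => hC (mem_range_self s)
  exact ⟨C, le_trans (by positivity) (hle 0), fun s => (div_le_iff₀ (K.speed_pos s)).1 (hle s)⟩

lemma exists_norm_tangent_sub_le :
    ∃ C : ℝ, 0 ≤ C ∧ ∀ a b, ‖K.tangent b - K.tangent a‖ ≤ C * |K.arcLength a b| := by
  obtain ⟨C, hC0, hC⟩ := K.exists_norm_deriv_tangent_le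
  refine ⟨C, hC0, fun a b => ?_⟩
  have hderiv := K.contDiff_tangent.continuous_deriv le_rfl
  calc ‖K.tangent b - K.tangent a‖ = ‖∫ u in a..b, deriv K.tangent u‖ := by
        rw [intervalIntegral.integral_deriv_eq_sub
          (fun u _ => K.contDiff_tangent.differentiable one_ne_zero u)
          (hderiv.intervalIntegrable a b)]
    _ ≤ |∫ u in a..b, C * ‖K.velocity u‖| :=
        intervalIntegral.norm_integral_le_abs_of_norm_le (ae_of_all _ hC)
          ((K.speed_intervalIntegrable a b).const_mul C)
    _ = C * |K.arcLength a b| := by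
        rw [intervalIntegral.integral_const_mul, abs_mul, abs_of_nonneg hC0, arcLength]

lemma integral_velocity (a b : ℝ) : ∫ u in a..b, K.velocity u = K.toFun b - K.toFun a :=
  intervalIntegral.integral_eq_sub_of_hasDerivAt (fun u _ => K.hasDerivAt_toFun u)
    (K.continuous_velocity.intervalIntegrable a b)

lemma norm_chord_le (a b : ℝ) : ‖K.toFun b - K.toFun a‖ ≤ |K.arcLength a b| := by
  rw [← K.integral_velocity]
  exact intervalIntegral.norm_integral_le_abs_integral_norm

lemma inner_chord_sub_arcLength (e : E3) (a b : ℝ) :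
    ⟪e, K.toFun b - K.toFun a⟫ - K.arcLength a b =
      ∫ u in a..b, (⟪e, K.velocity u⟫ - ‖K.velocity u‖) := by
  have hinner : Continuous fun u => ⟪e, K.velocity u⟫ := by fun_prop
  rw [intervalIntegral.integral_sub (hinner.intervalIntegrable a b)
    (K.speed_intervalIntegrable a b), ← K.integral_velocity]
  exact congrArg (· - _) ((innerSL ℝ e).intervalIntegral_comp_comm
    (K.continuous_velocity.intervalIntegrable a b)).symm

/-- For unit vectors `⟪T, T'⟫ = 1 - ‖T - T'‖² / 2`, so the error is of third order although the
tangent turns at first order. -/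
lemma exists_abs_inner_tangent_chord_sub_le : ∃ C : ℝ, 0 ≤ C ∧ ∀ a b, ∀ c ∈ uIcc a b,
    |⟪K.tangent c, K.toFun b - K.toFun a⟫ - K.arcLength a b| ≤ C * |K.arcLength a b| ^ 3 := by
  obtain ⟨C, hC0, hC⟩ := K.exists_norm_tangent_sub_le
  refine ⟨C ^ 2 / 2, by positivity, fun a b c hc => ?_⟩
  set l := |K.arcLength a b|
  have hbound : ∀ u ∈ uIoc a b,
      ‖⟪K.tangent c, K.velocity u⟫ - ‖K.velocity u‖‖ ≤ C ^ 2 * l ^ 2 / 2 * ‖K.velocity u‖ := by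
    intro u hu
    have hturn : ‖K.tangent c - K.tangent u‖ ≤ C * l :=
      (hC u c).trans (by gcongr; exact K.abs_arcLength_mono (uIoc_subset_uIcc hu) hc)
    have hsq := norm_sub_sq_real (K.tangent c) (K.tangent u)
    rw [K.norm_tangent, K.norm_tangent] at hsq
    have hdefect : ⟪K.tangent c, K.velocity u⟫ - ‖K.velocity u‖ =
        -(‖K.tangent c - K.tangent u‖ ^ 2 / 2 * ‖K.velocity u‖) := by
      nth_rw 1 [← K.speed_smul_tangent u]
      rw [real_inner_smul_right, hsq]
      ring
    rw [hdefect, norm_neg, Real.norm_of_nonneg (by positivity), ← mul_pow]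
    gcongr
  rw [K.inner_chord_sub_arcLength, ← Real.norm_eq_abs]
  calc _ ≤ |∫ u in a..b, C ^ 2 * l ^ 2 / 2 * ‖K.velocity u‖| :=
        intervalIntegral.norm_integral_le_abs_of_norm_le
          ((ae_restrict_mem measurableSet_uIoc).mono hbound)
          ((K.speed_intervalIntegrable a b).const_mul _)
    _ = C ^ 2 * l ^ 2 / 2 * l := by
        rw [intervalIntegral.integral_const_mul, abs_mul, abs_of_nonneg (by positivity)]
        rfl
    _ = C ^ 2 / 2 * l ^ 3 := by ring

lemma exists_half_arcLength_le_norm_chord : ∃ r > 0, ∀ a b, |K.arcLength a b| ≤ r →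
    |K.arcLength a b| / 2 ≤ ‖K.toFun b - K.toFun a‖ := by
  obtain ⟨C, hC0, hC⟩ := K.exists_abs_inner_tangent_chord_sub_le
  refine ⟨√(1 / (2 * (C + 1))), by positivity, fun a b hr => ?_⟩
  have hinner := hC a b a left_mem_uIcc
  have hcs := abs_real_inner_le_norm (K.tangent a) (K.toFun b - K.toFun a)
  rw [K.norm_tangent, one_mul] at hcs
  rw [abs_sub_comm] at hinner
  have htri := abs_sub_abs_le_abs_sub (K.arcLength a b) ⟪K.tangent a, K.toFun b - K.toFun a⟫
  have hl : 0 ≤ |K.arcLength a b| := abs_nonneg _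
  generalize |K.arcLength a b| = l at *
  suffices C * l ^ 3 ≤ l / 2 by linarith [le_abs_self ⟪K.tangent a, K.toFun b - K.toFun a⟫]
  calc C * l ^ 3 ≤ (C + 1) * √(1 / (2 * (C + 1))) ^ 2 * l := by
        rw [pow_succ, ← mul_assoc]; gcongr; linarith
    _ = l / 2 := by rw [Real.sq_sqrt (by positivity)]; field_simp

lemma exists_le_norm_chord {r : ℝ} (hr : 0 < r) : ∃ δ > 0, ∀ a b, r ≤ |K.arcLength a b| →
    |K.arcLength a b| ≤ K.length / 2 → δ ≤ ‖K.toFun b - K.toFun a‖ := by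
  set D : Set (ℝ × ℝ) := (Icc 0 1 ×ˢ Icc (-1) 2) ∩
    {p | r ≤ |K.arcLength p.1 p.2| ∧ |K.arcLength p.1 p.2| ≤ K.length / 2}
  have hcompact : IsCompact D := (isCompact_Icc.prod isCompact_Icc).inter_right
    ((isClosed_le continuous_const K.continuous_arcLength.abs).inter
      (isClosed_le K.continuous_arcLength.abs continuous_const))
  have hpos : ∀ p ∈ D, 0 < ‖K.toFun p.2 - K.toFun p.1‖ := by
    rintro ⟨a, b⟩ ⟨-, hra, hle⟩
    refine norm_sub_pos_iff.2 (K.toFun_ne ?_ (K.abs_sub_lt_one ?_)).symm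
    · intro (hab : a = b)
      rw [hab, K.arcLength_self, abs_zero] at hra
      linarith
    · linarith [K.length_pos]
  obtain ⟨δ, hδ, hδD⟩ := hcompact.exists_forall_le' (by fun_prop) hpos
  refine ⟨δ, hδ, fun a b hra hle => ?_⟩
  have htoFun : ∀ u, K.toFun (u - ⌊a⌋) = K.toFun u := fun u => by
    simpa using K.periodic.sub_zsmul_eq (x := u) ⌊a⌋
  have harc := K.arcLength_sub_intCast a b ⌊a⌋
  have hab := abs_lt.1 (K.abs_sub_lt_one (hle.trans_lt (half_lt_self K.length_pos)))
  have hfloor := Int.floor_le a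
  have hlt := Int.lt_floor_add_one a
  have hmem : (a - ⌊a⌋, b - ⌊a⌋) ∈ D := by
    refine ⟨⟨⟨?_, ?_⟩, ?_, ?_⟩, ?_⟩
    · linarith
    · linarith
    · linarith [hab.2]
    · linarith [hab.1]
    · rw [mem_ofPred_eq, harc]
      exact ⟨hra, hle⟩
  have hchord := hδD _ hmem
  rwa [htoFun, htoFun] at hchord

lemma exists_mul_arcLength_le_norm_chord : ∃ c > 0, ∀ a b, |K.arcLength a b| ≤ K.length / 2 →
    c * |K.arcLength a b| ≤ ‖K.toFun b - K.toFun a‖ := by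
  obtain ⟨r, hr, hsmall⟩ := K.exists_half_arcLength_le_norm_chord
  obtain ⟨δ, hδ, hlarge⟩ := K.exists_le_norm_chord hr
  have hL := K.length_pos
  refine ⟨min (1 / 2) (δ / K.length), lt_min (by norm_num) (by positivity), fun a b hle => ?_⟩
  rcases le_total |K.arcLength a b| r with h | h
  · calc _ ≤ 1 / 2 * |K.arcLength a b| := by gcongr; exact min_le_left _ _
      _ = |K.arcLength a b| / 2 := by ring
      _ ≤ _ := hsmall a b h
  · calc _ ≤ δ / K.length * K.length := by
          gcongr
          · exact min_le_right _ _
          · linarith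
      _ = δ := by field_simp
      _ ≤ _ := hlarge a b h hle

end Chord

section Integrands

lemma energyIntegrand_self (s : ℝ) : K.energyIntegrand (s, s) = 0 := by
  simp [energyIntegrand, arcDist, arcLength_self, K.length_pos.le]

lemma arcDist_comm (s t : ℝ) : K.arcDist t s = K.arcDist s t := by
  rw [arcDist, arcDist, K.arcLength_symm, abs_neg]

lemma arcDist_add_one_right {s t : ℝ} (hst : s ≤ t) (hts : t ≤ s + 1) :
    K.arcDist t (s + 1) = K.arcDist t s := by
  have hlong := K.arcLength_nonneg hts
  rw [K.arcDist_comm s t, arcDist, arcDist, abs_of_nonneg (K.arcLength_nonneg hst),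
    abs_of_nonneg hlong, K.arcLength_add_one_right, sub_sub_cancel, min_comm]

lemma energyIntegrand_comm (s t : ℝ) : K.energyIntegrand (t, s) = K.energyIntegrand (s, t) := by
  simp only [energyIntegrand, K.arcDist_comm s t, norm_sub_rev (K.toFun t), mul_comm ‖K.velocity t‖]

lemma energyIntegrand_add_one_right {s t : ℝ} (hst : s ≤ t) (hts : t ≤ s + 1) :
    K.energyIntegrand (t, s + 1) = K.energyIntegrand (t, s) := by
  simp only [energyIntegrand, K.periodic s, K.velocity_periodic s, K.arcDist_add_one_right hst hts]

lemma energyIntegrand_of_abs_arcLength_le {s t : ℝ} (h : |K.arcLength s t| ≤ K.length / 2) :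
    K.energyIntegrand (s, t) = (1 / ‖K.toFun s - K.toFun t‖ ^ 2 - 1 / K.arcLength s t ^ 2) *
      (‖K.velocity s‖ * ‖K.velocity t‖) := by
  rw [energyIntegrand, arcDist, min_eq_left (by linarith), sq_abs]

/-- The coefficient of `|Ω_K| - Re Ω_K` with respect to `ds dt`, in closed form. -/
def conformalIntegrand (p : ℝ × ℝ) : ℝ :=
  conformalDefect (K.toFun p.1 - K.toFun p.2) (K.velocity p.1) (K.velocity p.2)

lemma conformalIntegrand_self (s : ℝ) : K.conformalIntegrand (s, s) = 0 := by
  rw [conformalIntegrand, sub_self, conformalDefect_zero]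

lemma conformalIntegrand_comm (s t : ℝ) :
    K.conformalIntegrand (t, s) = K.conformalIntegrand (s, t) :=
  conformalDefect_sub_comm _ _ _ _

lemma conformalIntegrand_add_one_right (s t : ℝ) :
    K.conformalIntegrand (t, s + 1) = K.conformalIntegrand (t, s) := by
  simp only [conformalIntegrand, K.periodic s, K.velocity_periodic s]

lemma conformalIntegrand_eq_speed_mul (s t : ℝ) :
    K.conformalIntegrand (s, t) = ‖K.velocity s‖ * ‖K.velocity t‖ *
      conformalDefect (K.toFun s - K.toFun t) (K.tangent s) (K.tangent t) := by
  rw [← conformalDefect_smul_smul _ _ _ (norm_nonneg _) (norm_nonneg _), speed_smul_tangent,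
    speed_smul_tangent, conformalIntegrand]

/-- Of the two arcs between two points of the knot one has length at most `L / 2`, so a symmetric
and rotation invariant property has to be checked on such arcs only. -/
lemma short_arc_induction {P : ℝ → ℝ → Prop} (self : ∀ s, P s s) (symm : ∀ s t, P s t → P t s)
    (add_one : ∀ s t, s ≤ t → t ≤ s + 1 → P t (s + 1) → P t s)
    (short : ∀ a b, a < b → K.arcLength a b ≤ K.length / 2 → P a b) {s t : ℝ}
    (h : |s - t| ≤ 1) : P s t := by
  have hle : ∀ a b, a ≤ b → K.arcLength a b ≤ K.length / 2 → P a b := fun a b hab hshort =>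
    hab.eq_or_lt.elim (fun h => h ▸ self a) fun h => short a b h hshort
  wlog hst : s ≤ t generalizing s t
  · exact symm t s (this (by rwa [abs_sub_comm]) (le_of_not_ge hst))
  rcases le_total (K.arcLength s t) (K.length / 2) with hshort | hlong
  · exact hle s t hst hshort
  · have hts : t ≤ s + 1 := by linarith [(abs_le.1 h).1]
    refine symm t s (add_one s t hst hts (hle t (s + 1) hts ?_))
    rw [K.arcLength_add_one_right]
    linarith

lemma exists_speed_le : ∃ B, ∀ s, ‖K.velocity s‖ ≤ B := by
  obtain ⟨B, hB⟩ := (K.velocity_periodic.isBounded_of_continuous one_ne_zero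
    K.continuous_velocity).exists_norm_le
  exact ⟨B, fun s => hB _ (mem_range_self s)⟩

lemma exists_arcLength_sub_le_inner_tangent_chord : ∃ C : ℝ, ∀ a b, a ≤ b → ∀ c ∈ Icc a b,
    K.arcLength a b - C * K.arcLength a b ^ 3 ≤ ⟪K.tangent c, K.toFun b - K.toFun a⟫ := by
  obtain ⟨C, -, hC⟩ := K.exists_abs_inner_tangent_chord_sub_le
  refine ⟨C, fun a b hab c hc => ?_⟩
  have hinner := hC a b c (Icc_subset_uIcc hc)
  rw [abs_of_nonneg (K.arcLength_nonneg hab)] at hinner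
  linarith [(abs_le.1 hinner).1]

lemma exists_abs_energyIntegrand_le : ∃ M, ∀ s t, |s - t| ≤ 1 → |K.energyIntegrand (s, t)| ≤ M := by
  obtain ⟨B, hB⟩ := K.exists_speed_le
  obtain ⟨C, hC⟩ := K.exists_arcLength_sub_le_inner_tangent_chord
  obtain ⟨c, hc0, hc⟩ := K.exists_mul_arcLength_le_norm_chord
  have hB0 : 0 ≤ B := (norm_nonneg _).trans (hB 0)
  refine ⟨2 * |C| / c ^ 2 * (B * B), fun s t => K.short_arc_induction
    (P := fun s t => |K.energyIntegrand (s, t)| ≤ _) ?_ ?_ ?_ ?_⟩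
  · intro s
    rw [energyIntegrand_self, abs_zero]
    positivity
  · exact fun s t h => by rwa [energyIntegrand_comm]
  · exact fun s t hst hts h => by rwa [← K.energyIntegrand_add_one_right hst hts]
  · intro a b hab hshort
    have hh := K.arcLength_pos hab
    have habs := abs_of_pos hh
    have hlower : K.arcLength a b - C * K.arcLength a b ^ 3 ≤ ‖K.toFun b - K.toFun a‖ := by
      have hcs := real_inner_le_norm (K.tangent a) (K.toFun b - K.toFun a)
      rw [K.norm_tangent, one_mul] at hcs
      exact (hC a b hab.le a (left_mem_Icc.2 hab.le)).trans hcs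
    have hchord := abs_one_div_sq_sub_one_div_sq_le hc0 hh hlower
      (by simpa only [habs] using K.norm_chord_le a b)
      (by simpa only [habs] using hc a b (by rwa [habs]))
    rw [K.energyIntegrand_of_abs_arcLength_le (by rwa [habs]), norm_sub_rev, abs_mul,
      abs_of_nonneg (by positivity : 0 ≤ ‖K.velocity a‖ * ‖K.velocity b‖)]
    gcongr
    · exact hchord.trans (by gcongr; exact le_abs_self C)
    · exact hB a
    · exact hB b

lemma exists_abs_conformalIntegrand_le :
    ∃ M, ∀ s t, |s - t| ≤ 1 → |K.conformalIntegrand (s, t)| ≤ M := by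
  obtain ⟨B, hB⟩ := K.exists_speed_le
  obtain ⟨C, hC⟩ := K.exists_arcLength_sub_le_inner_tangent_chord
  obtain ⟨c, hc0, hc⟩ := K.exists_mul_arcLength_le_norm_chord
  have hB0 : 0 ≤ B := (norm_nonneg _).trans (hB 0)
  refine ⟨B * B * (4 * |C| / c ^ 4), fun s t => K.short_arc_induction
    (P := fun s t => |K.conformalIntegrand (s, t)| ≤ _) ?_ ?_ ?_ ?_⟩
  · intro s
    rw [conformalIntegrand_self, abs_zero]
    positivity
  · exact fun s t h => by rwa [conformalIntegrand_comm]
  · exact fun s t _ _ h => by rwa [← K.conformalIntegrand_add_one_right]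
  · intro a b hab hshort
    have hh := K.arcLength_pos hab
    have habs := abs_of_pos hh
    have hdefect := abs_conformalDefect_le (K.norm_tangent b) (K.norm_tangent a) hc0 hh
      (hC a b hab.le b (right_mem_Icc.2 hab.le)) (hC a b hab.le a (left_mem_Icc.2 hab.le))
      (by simpa only [habs] using K.norm_chord_le a b)
      (by simpa only [habs] using hc a b (by rwa [habs]))
    rw [conformalIntegrand_eq_speed_mul, ← conformalDefect_sub_comm, abs_mul,
      abs_of_nonneg (by positivity : 0 ≤ ‖K.velocity a‖ * ‖K.velocity b‖)]
    gcongr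
    · exact hB a
    · exact hB b
    · exact hdefect.trans (by gcongr; exact le_abs_self C)

@[fun_prop]
lemma continuous_arcDist : Continuous fun p : ℝ × ℝ => K.arcDist p.1 p.2 :=
  K.continuous_arcLength.abs.min (continuous_const.sub K.continuous_arcLength.abs)

@[fun_prop]
lemma measurable_energyIntegrand : Measurable K.energyIntegrand := by
  have harc := K.continuous_arcDist.measurable
  have htoFun := K.continuous_toFun.measurable
  have hvelocity := K.continuous_velocity.measurable
  unfold energyIntegrand
  fun_prop

@[fun_prop]
lemma measurable_conformalIntegrand : Measurable K.conformalIntegrand := by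
  have htoFun := K.continuous_toFun.measurable
  have hvelocity := K.continuous_velocity.measurable
  unfold conformalIntegrand conformalDefect mixedLogDeriv
  fun_prop

lemma measurableSet_square : MeasurableSet square := measurableSet_Ico.prod measurableSet_Ico

lemma integrableOn_square_of_abs_le {f : ℝ × ℝ → ℝ} (hf : Measurable f)
    (hbound : ∃ M, ∀ s t, |s - t| ≤ 1 → |f (s, t)| ≤ M) : IntegrableOn f square := by
  obtain ⟨M, hM⟩ := hbound
  have hfinite : volume square ≠ ⊤ := by
    simp [square, Measure.volume_eq_prod, Measure.prod_prod]
  refine Measure.integrableOn_of_bounded (M := M) hfinite hf.aestronglyMeasurable ?_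
  refine (ae_restrict_mem measurableSet_square).mono fun p hp => hM p.1 p.2 ?_
  exact abs_le.2 ⟨by linarith [hp.1.1, hp.2.2], by linarith [hp.1.2, hp.2.1]⟩

lemma integrableOn_energyIntegrand : IntegrableOn K.energyIntegrand square :=
  integrableOn_square_of_abs_le K.measurable_energyIntegrand K.exists_abs_energyIntegrand_le

lemma integrableOn_conformalIntegrand : IntegrableOn K.conformalIntegrand square :=
  integrableOn_square_of_abs_le K.measurable_conformalIntegrand K.exists_abs_conformalIntegrand_le

end Integrands

section Difference

/-- The derivative of `log (‖K s - K t‖ / |arcLength s t|)` in `s`, as a function of `t`; it is a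
primitive of the difference of the two integrands. At `t = s` both quotients are `x / 0 = 0`, and
`0` is the limit there. -/
def logChordArcDeriv (s t : ℝ) : ℝ :=
  ⟪K.velocity s, K.toFun s - K.toFun t⟫ / ‖K.toFun s - K.toFun t‖ ^ 2 +
    ‖K.velocity s‖ / K.arcLength s t

lemma logChordArcDeriv_self (s : ℝ) : K.logChordArcDeriv s s = 0 := by
  simp [logChordArcDeriv, arcLength_self]

lemma logChordArcDeriv_eq_speed_mul (s t : ℝ) :
    K.logChordArcDeriv s t = ‖K.velocity s‖ * (1 / K.arcLength s t -
      ⟪K.tangent s, K.toFun t - K.toFun s⟫ / ‖K.toFun t - K.toFun s‖ ^ 2) := by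
  rw [logChordArcDeriv, ← neg_sub (K.toFun t), norm_neg, inner_neg_right,
    ← congrArg (⟪·, K.toFun t - K.toFun s⟫) (K.speed_smul_tangent s), real_inner_smul_left]
  ring

lemma toFun_ne_of_abs_arcLength_le {s t : ℝ} (hst : s ≠ t)
    (h : |K.arcLength s t| ≤ K.length / 2) : K.toFun s ≠ K.toFun t :=
  K.toFun_ne hst (K.abs_sub_lt_one (h.trans_lt (half_lt_self K.length_pos)))

lemma hasDerivAt_logChordArcDeriv {s t : ℝ} (hst : s ≠ t)
    (h : |K.arcLength s t| ≤ K.length / 2) : HasDerivAt (K.logChordArcDeriv s)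
      (K.energyIntegrand (s, t) - K.conformalIntegrand (s, t)) t := by
  have harc := K.arcLength_ne_zero hst
  refine ((hasDerivAt_inner_div_norm_sq _ (K.velocity s) (K.hasDerivAt_toFun t)
    (K.toFun_ne_of_abs_arcLength_le hst h)).add ((hasDerivAt_const t ‖K.velocity s‖).div
      (K.hasDerivAt_arcLength s t) harc)).congr_deriv ?_
  rw [K.energyIntegrand_of_abs_arcLength_le h, conformalIntegrand, conformalDefect]
  ring

lemma exists_abs_logChordArcDeriv_le : ∃ M, ∀ s t, |K.arcLength s t| ≤ K.length / 2 →
    |K.logChordArcDeriv s t| ≤ M * ‖K.velocity s‖ * |K.arcLength s t| := by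
  obtain ⟨C, -, hC⟩ := K.exists_abs_inner_tangent_chord_sub_le
  obtain ⟨c, hc0, hc⟩ := K.exists_mul_arcLength_le_norm_chord
  refine ⟨3 * C / c ^ 2, fun s t h => ?_⟩
  rcases eq_or_ne s t with rfl | hst
  · simp [logChordArcDeriv_self, arcLength_self]
  have hcs := abs_real_inner_le_norm (K.tangent s) (K.toFun t - K.toFun s)
  rw [K.norm_tangent, one_mul] at hcs
  rw [logChordArcDeriv_eq_speed_mul, abs_mul, abs_norm, mul_right_comm, mul_comm]
  gcongr
  exact abs_one_div_sub_div_sq_le hc0 (K.arcLength_ne_zero hst) (hC s t s left_mem_uIcc) hcs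
    (K.norm_chord_le s t) (hc s t h)

lemma continuousAt_logChordArcDeriv_self (s : ℝ) : ContinuousAt (K.logChordArcDeriv s) s := by
  obtain ⟨M, hM⟩ := K.exists_abs_logChordArcDeriv_le
  have harc : ContinuousAt (fun t => |K.arcLength s t|) s :=
    (K.continuous_arcLength_right s).abs.continuousAt
  have hshort : ∀ᶠ t in 𝓝 s, |K.arcLength s t| < K.length / 2 :=
    harc.eventually_lt_const (by simpa [arcLength_self] using K.length_pos)
  have hlim : Tendsto (fun t => M * ‖K.velocity s‖ * |K.arcLength s t|) (𝓝 s) (𝓝 0) := by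
    simpa [arcLength_self] using (harc.const_mul (M * ‖K.velocity s‖)).tendsto
  rw [ContinuousAt, logChordArcDeriv_self]
  exact squeeze_zero_norm' (hshort.mono fun t ht => hM s t ht.le) hlim

lemma integrand_sub_intervalIntegrable {s a b : ℝ} (hab : uIcc a b ⊆ Icc (s - 1) (s + 1)) :
    IntervalIntegrable (fun t => K.energyIntegrand (s, t) - K.conformalIntegrand (s, t))
      volume a b := by
  obtain ⟨M, hM⟩ := K.exists_abs_energyIntegrand_le
  obtain ⟨M', hM'⟩ := K.exists_abs_conformalIntegrand_le
  refine (intervalIntegrable_const (c := M + M')).mono_fun'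
    (by fun_prop : Measurable _).aestronglyMeasurable ?_
  refine (ae_restrict_mem measurableSet_uIoc).mono fun t ht => ?_
  have hst : |s - t| ≤ 1 := mem_Icc_iff_abs_le.2 (hab (uIoc_subset_uIcc ht))
  exact (abs_sub _ _).trans (add_le_add (hM s t hst) (hM' s t hst))

lemma integral_integrand_sub_of_abs_arcLength_le {s m : ℝ}
    (h : |K.arcLength s m| ≤ K.length / 2) :
    ∫ t in s..m, (K.energyIntegrand (s, t) - K.conformalIntegrand (s, t)) =
      K.logChordArcDeriv s m := by
  have hshort : ∀ t ∈ uIcc s m, |K.arcLength s t| ≤ K.length / 2 := fun t ht =>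
    (K.abs_arcLength_mono left_mem_uIcc ht).trans h
  have hsub : uIcc s m ⊆ Icc (s - 1) (s + 1) := fun t ht => mem_Icc_iff_abs_le.1
    (K.abs_sub_lt_one ((hshort t ht).trans_lt (half_lt_self K.length_pos))).le
  rw [integral_eq_of_hasDerivAt_off_countable (K.logChordArcDeriv s) _ (countable_singleton s) ?_ ?_
    (K.integrand_sub_intervalIntegrable hsub), logChordArcDeriv_self, sub_zero]
  · intro t ht
    rcases eq_or_ne s t with rfl | hst
    · exact (K.continuousAt_logChordArcDeriv_self s).continuousWithinAt
    · exact (K.hasDerivAt_logChordArcDeriv hst (hshort t ht)).continuousAt.continuousWithinAt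
  · rintro t ⟨ht, hts⟩
    exact K.hasDerivAt_logChordArcDeriv (Ne.symm hts) (hshort t (Ioo_subset_Icc_self ht))

lemma exists_arcLength_eq_half (s : ℝ) :
    ∃ m ∈ Ioo s (s + 1), K.arcLength s m = K.length / 2 := by
  have hL := K.length_pos
  exact intermediate_value_Ioo (by linarith) (K.continuous_arcLength_right s).continuousOn
    (by rw [arcLength_self, arcLength_add_one]; constructor <;> linarith)

lemma logChordArcDeriv_add_one (s t : ℝ) :
    K.logChordArcDeriv (s + 1) t = K.logChordArcDeriv s t - ‖K.velocity s‖ / K.arcLength s t -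
      ‖K.velocity s‖ / (K.length - K.arcLength s t) := by
  rw [logChordArcDeriv, logChordArcDeriv, K.periodic, K.velocity_periodic, K.arcLength_symm,
    K.arcLength_add_one_right, div_neg]
  ring

/-- Beyond the antipode of `s` the shorter arc is the one to `s + 1`. The jump of the primitive at
the antipode is the whole integral. -/
lemma integral_integrand_sub_add_one (s : ℝ) :
    ∫ t in s..s + 1, (K.energyIntegrand (s, t) - K.conformalIntegrand (s, t)) =
      4 * ‖K.velocity s‖ / K.length := by
  obtain ⟨m, ⟨hsm, hms⟩, hm⟩ := K.exists_arcLength_eq_half s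
  have hL := K.length_pos
  have hint : ∀ {a b}, a ∈ Icc s (s + 1) → b ∈ Icc s (s + 1) → IntervalIntegrable
      (fun t => K.energyIntegrand (s, t) - K.conformalIntegrand (s, t)) volume a b :=
    fun ha hb => K.integrand_sub_intervalIntegrable
      ((uIcc_subset_Icc ha hb).trans (Icc_subset_Icc_left (by linarith)))
  have hfirst := K.integral_integrand_sub_of_abs_arcLength_le (s := s) (m := m)
    (by rw [hm, abs_of_pos (half_pos hL)])
  have hsecond := K.integral_integrand_sub_of_abs_arcLength_le (s := s + 1) (m := m) <| by
    rw [K.arcLength_symm, K.arcLength_add_one_right, hm, sub_half, abs_neg,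
      abs_of_pos (half_pos hL)]
  have hshift : EqOn (fun t => K.energyIntegrand (s + 1, t) - K.conformalIntegrand (s + 1, t))
      (fun t => K.energyIntegrand (s, t) - K.conformalIntegrand (s, t)) (uIcc (s + 1) m) := by
    intro t ht
    rw [uIcc_of_ge hms.le] at ht
    simp only [← K.energyIntegrand_comm _ t, ← K.conformalIntegrand_comm _ t,
      K.energyIntegrand_add_one_right (hsm.le.trans ht.1) ht.2, K.conformalIntegrand_add_one_right]
  rw [intervalIntegral.integral_congr hshift, intervalIntegral.integral_symm,
    logChordArcDeriv_add_one, hm] at hsecond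
  rw [← intervalIntegral.integral_add_adjacent_intervals
    (hint (b := m) (by simp) ⟨hsm.le, hms.le⟩) (hint ⟨hsm.le, hms.le⟩ (by simp)), hfirst,
    neg_eq_iff_eq_neg.1 hsecond]
  field_simp
  ring

lemma integral_integrand_sub {s : ℝ} (hs : s ∈ Icc (0 : ℝ) 1) :
    ∫ t in (0 : ℝ)..1, (K.energyIntegrand (s, t) - K.conformalIntegrand (s, t)) =
      4 * ‖K.velocity s‖ / K.length := by
  have hint : ∀ {a b}, a ∈ Icc 0 (s + 1) → b ∈ Icc 0 (s + 1) → IntervalIntegrable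
      (fun t => K.energyIntegrand (s, t) - K.conformalIntegrand (s, t)) volume a b :=
    fun ha hb => K.integrand_sub_intervalIntegrable
      ((uIcc_subset_Icc ha hb).trans (Icc_subset_Icc_left (by linarith [hs.2])))
  have h0 : (0 : ℝ) ∈ Icc 0 (s + 1) := ⟨le_rfl, by linarith [hs.1]⟩
  have h1 : (1 : ℝ) ∈ Icc 0 (s + 1) := ⟨zero_le_one, by linarith [hs.1]⟩
  have hss : s ∈ Icc 0 (s + 1) := ⟨hs.1, by linarith⟩
  have hss1 : s + 1 ∈ Icc 0 (s + 1) := ⟨by linarith [hs.1], le_rfl⟩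
  have hshift : ∫ t in (0 : ℝ)..s, (K.energyIntegrand (s, t) - K.conformalIntegrand (s, t)) =
      ∫ t in (1 : ℝ)..s + 1, (K.energyIntegrand (s, t) - K.conformalIntegrand (s, t)) := by
    rw [← intervalIntegral.integral_congr (f := fun t =>
        K.energyIntegrand (s, t + 1) - K.conformalIntegrand (s, t + 1)),
      intervalIntegral.integral_comp_add_right
        (fun t => K.energyIntegrand (s, t) - K.conformalIntegrand (s, t)), zero_add]
    intro t ht
    rw [uIcc_of_le hs.1] at ht
    simp only [K.energyIntegrand_add_one_right ht.2 (by linarith [hs.2, ht.1]),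
      K.conformalIntegrand_add_one_right]
  rw [← K.integral_integrand_sub_add_one s,
    ← intervalIntegral.integral_add_adjacent_intervals (hint h0 hss) (hint hss h1),
    hshift, add_comm,
    intervalIntegral.integral_add_adjacent_intervals (hint hss h1) (hint h1 hss1)]

lemma integral_square_integrand_sub :
    ∫ p in square, (K.energyIntegrand p - K.conformalIntegrand p) = 4 := by
  have hint : IntegrableOn (fun p => K.energyIntegrand p - K.conformalIntegrand p) square :=
    K.integrableOn_energyIntegrand.sub K.integrableOn_conformalIntegrand
  have hslice : ∀ s ∈ Ico (0 : ℝ) 1,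
      ∫ t in Ico (0 : ℝ) 1, (K.energyIntegrand (s, t) - K.conformalIntegrand (s, t)) =
        4 * ‖K.velocity s‖ / K.length := fun s hs => by
    rw [← K.integral_integrand_sub (Ico_subset_Icc_self hs), integral_Ico_eq_integral_Ioc,
      intervalIntegral.integral_of_le zero_le_one]
  rw [square, Measure.volume_eq_prod] at hint ⊢
  rw [setIntegral_prod _ hint, setIntegral_congr_fun measurableSet_Ico hslice,
    integral_Ico_eq_integral_Ioc, ← intervalIntegral.integral_of_le zero_le_one,
    intervalIntegral.integral_div, intervalIntegral.integral_const_mul]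
  exact mul_div_cancel_right₀ 4 K.length_pos.ne'

lemma energy_eq_integral_conformalIntegrand :
    K.energy = ∫ p in square, K.conformalIntegrand p := by
  have hsub := K.integral_square_integrand_sub
  rw [integral_sub K.integrableOn_energyIntegrand K.integrableOn_conformalIntegrand] at hsub
  rw [energy]
  linarith

end Difference

section OffDiagonal

lemma offDiagSquare_subset_square : offDiagSquare ⊆ square := sep_subset _ _

lemma measurableSet_offDiagSquare : MeasurableSet offDiagSquare :=
  measurableSet_square.inter (measurableSet_eq_fun measurable_fst measurable_snd).compl

lemma toFun_ne_of_mem_offDiagSquare {p : ℝ × ℝ} (hp : p ∈ offDiagSquare) :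
    K.toFun p.1 ≠ K.toFun p.2 := fun h => hp.2 (K.injOn hp.1.1 hp.1.2 h)

lemma crossRatioIntegrand_eqOn :
    EqOn (crossRatioIntegrand K) K.conformalIntegrand offDiagSquare := fun _ hp =>
  crossRatioIntegrand_eq_conformalDefect (K.toFun_ne_of_mem_offDiagSquare hp)

lemma integral_offDiagSquare_conformalIntegrand :
    ∫ p in offDiagSquare, K.conformalIntegrand p = ∫ p in square, K.conformalIntegrand p := by
  refine (setIntegral_eq_of_subset_of_forall_sdiff_eq_zero measurableSet_square
    offDiagSquare_subset_square ?_).symm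
  rintro ⟨s, t⟩ ⟨hp, hdiag⟩
  obtain rfl : s = t := not_not.1 fun hst => hdiag ⟨hp, hst⟩
  exact K.conformalIntegrand_self s

end OffDiagonal

end Knot

end

theorem mainTheorem1 (K : Knot) :
    (∀ p ∈ Knot.offDiagSquare, ∃! ω : ℂ, IsInfinitesimalCrossRatio K p.1 p.2 ω) ∧
    MeasureTheory.IntegrableOn K.energyIntegrand Knot.square ∧
    MeasureTheory.IntegrableOn (crossRatioIntegrand K) Knot.offDiagSquare ∧
    K.energy = ∫ p in Knot.offDiagSquare, crossRatioIntegrand K p := by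
  refine ⟨fun p hp => existsUnique_isInfinitesimalCrossRatio (K.toFun_ne_of_mem_offDiagSquare hp),
    K.integrableOn_energyIntegrand, ?_, ?_⟩
  · exact (K.integrableOn_conformalIntegrand.mono_set Knot.offDiagSquare_subset_square).congr_fun
      K.crossRatioIntegrand_eqOn.symm Knot.measurableSet_offDiagSquare
  · rw [MeasureTheory.setIntegral_congr_fun Knot.measurableSet_offDiagSquare
      K.crossRatioIntegrand_eqOn, K.integral_offDiagSquare_conformalIntegrand,
      K.energy_eq_integral_conformalIntegrand]
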